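/- Let $\mathcal C$ be a strict 2-category that is representable, i.e. it has 2-pullbacks and, for each object $B$, a comma object $\Phi B$ of $(1_B,1_B)$ with projections $d_0,d_1:\Phi B\to B$; then for each 1-cell $p:E\to B$ the comma object $p/B$ of $(p,1_B)$ exists, with projections $d_0:p/B\to E$, $d_1:p/B\to B$ and universal 2-cell $\lambda: p d_0\Rightarrow d_1$. Fix a choice of these comma objects, with $\Phi B=1_B/B$. Let $\mathrm{Arr}\,\mathcal C$ be the arrow 2-category (objects: 1-cells $p:E\to B$; 1-cells $f=(f^\uparrow,f_\downarrow)$: strictly commuting squares; 2-cells: compatible pairs of 2-cells), with 2-functors $\mathrm{dom},\mathrm{cod}:\mathrm{Arr}\,\mathcal C\to\mathcal C$. Let $(L_\bullet,i,c)$ be the 2-monad on $\mathrm{Arr}\,\mathcal C$ given by $L_\bullet(p:E\to B)=(d_1:p/B\to B)$, where $L_\bullet f$ is over $f_\downarrow$ and $L_\bullet\alpha$ is over $\alpha_\downarrow$ with upstairs parts induced by the universal property; $i_p$ is over $1_B$ and $i_p^\uparrow$ is determined by $d_0i_p^\uparrow=1_E$, $d_1i_p^\uparrow=p$, $\lambda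 i_p^\uparrow=1_p$; $c_p$ is over $1_B$ and, with primes marking the comma object $d_1/B$, $c_p^\uparrow$ is determined by $d_0c_p^\uparrow=d_0d_0'$, $d_1c_p^\uparrow=d_1'$, $\lambda c_p^\uparrow=\lambda'\cdot(\lambda d_0')$. For $n\ge 0$ let $K_n$ be the 2-endofunctor of $\mathrm{Arr}\,\mathcal C$ which sends $p:E\to B$ to $\mathrm{dom}\,L_\bullet^n$ applied to the 1-cell $(p,1_B):p\to 1_B$ of $\mathrm{Arr}\,\mathcal C$; so $K_0=\mathrm{Id}$. Let $d_0:K_{n+1}\to K_n$ be the 2-natural transformation with components $d_0$ upstairs and downstairs, and let $d_1:K_1\to L_\bullet$ be the one whose component at $p$ is $1_{p/B}$ upstairs and $d_1:\Phi B\to B$ downstairs. Let $T_\bullet:\mathrm{Arr}\,\mathcal C\to\mathrm{Arr}\,\mathcal C$ be an indexed bundle 2-endofunctor, i.e. a 2-functor with $\mathrm{cod}\,T_\bullet=\mathrm{cod}$ that sends pullback squares to pullback squares. Then: 1. There is a unique sequence of 2-natural transformations $\psi_n:T_\bullet K_n\to K_nT_\bullet$ $(n\ge0)$ such that $\psi_0$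 is the identity, each $\mathrm{cod}\,\psi_{n+1}$ is an identity, and $(d_0T_\bullet)\circ\psi_{n+1}=\psi_n\circ(T_\bullet d_0)$. Each $\psi_n$ is a 2-natural isomorphism. 2. There is a unique 2-natural transformation $\Psi_\bullet:L_\bullet T_\bullet\to T_\bullet L_\bullet$ such that $\mathrm{cod}\,\Psi_\bullet$ is an identity and $\Psi_\bullet\circ(d_1T_\bullet)\circ\psi_1=T_\bullet d_1$. 3. This $\Psi_\bullet$ is a 2-transition (monad opfunctor) from $(\mathrm{Arr}\,\mathcal C,L_\bullet)$ to itself along $T_\bullet$, i.e. $$\Psi_\bullet\circ(iT_\bullet)=T_\bullet i,\qquad \Psi_\bullet\circ(cT_\bullet)=(T_\bullet c)\circ(\Psi_\bullet L_\bullet)\circ(L_\bullet\Psi_\bullet).$$ -/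

import Mathlib

open CategoryTheory Bicategory

universe w v u w₁ v₁ u₁ w₂ v₂ u₂ w₃ v₃ u₃

namespace ArrowTwoCat

section Cells

/-! ### Calculus of 2-cells in a strict 2-category

In a strict 2-category two 2-cells whose boundaries are only propositionally equal are compared as
arrows of the hom-category, where identity coherence cells disappear. -/

variable {B : Type u} [Bicategory.{w, v} B]

/-- Whiskering `f ◁ x` of an unbundled 2-cell `x`. -/
def wl {a b c : B} (f : a ⟶ b) (x : Arrow (b ⟶ c)) : Arrow (a ⟶ c) := Arrow.mk (f ◁ x.hom)

/-- Whiskering `x ▷ f` of an unbundled 2-cell `x`. -/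
def wr {a b c : B} (x : Arrow (a ⟶ b)) (f : b ⟶ c) : Arrow (a ⟶ c) := Arrow.mk (x.hom ▷ f)

theorem mk_wl {a b c : B} (f : a ⟶ b) {g h : b ⟶ c} (η : g ⟶ h) :
    Arrow.mk (f ◁ η) = wl f (Arrow.mk η) := rfl

theorem mk_wr {a b c : B} {g h : a ⟶ b} (η : g ⟶ h) (f : b ⟶ c) :
    Arrow.mk (η ▷ f) = wr (Arrow.mk η) f := rfl

theorem mk_eqToHom {a b : B} {f g : a ⟶ b} (h : f = g) :
    Arrow.mk (eqToHom h) = Arrow.mk (𝟙 f) := by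
  subst h; rfl

theorem mk_comp_congr {a b : B} {f g h f' g' h' : a ⟶ b} {η : f ⟶ g} {θ : g ⟶ h}
    {η' : f' ⟶ g'} {θ' : g' ⟶ h'} (h₁ : Arrow.mk η = Arrow.mk η')
    (h₂ : Arrow.mk θ = Arrow.mk θ') : Arrow.mk (η ≫ θ) = Arrow.mk (η' ≫ θ') := by
  obtain ⟨e₁, e₂, e₃⟩ := (Arrow.mk_eq_mk_iff _ _).1 h₁
  obtain ⟨e₄, e₅, e₆⟩ := (Arrow.mk_eq_mk_iff _ _).1 h₂
  subst e₁ e₂ e₅ e₃ e₆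
  simp

theorem eq_conj_iff {a b : B} {f g f' g' : a ⟶ b} (η : f ⟶ g) (θ : f' ⟶ g') (h : f = f')
    (h' : g' = g) : η = eqToHom h ≫ θ ≫ eqToHom h' ↔ Arrow.mk η = Arrow.mk θ := by
  subst h h'
  simp [Arrow.mk_inj]

/-- Vertical composition of unbundled 2-cells whose common boundary is a propositional equality. -/
def vc {a b : B} (x y : Arrow (a ⟶ b)) (h : x.right = y.left) : Arrow (a ⟶ b) :=
  Arrow.mk (x.hom ≫ eqToHom h ≫ y.hom)

theorem mk_comp {a b : B} {f g h : a ⟶ b} (η : f ⟶ g) (θ : g ⟶ h) :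
    Arrow.mk (η ≫ θ) = vc (Arrow.mk η) (Arrow.mk θ) rfl := by simp [vc]

theorem vc_congr {a b : B} {x y x' y' : Arrow (a ⟶ b)} (hx : x = x') (hy : y = y')
    (h : x.right = y.left) : vc x y h = vc x' y' (hx ▸ hy ▸ h) := by
  subst hx hy; rfl

theorem vc_assoc {a b : B} (x y z : Arrow (a ⟶ b)) (h : x.right = y.left) (h' : y.right = z.left) :
    vc (vc x y h) z h' = vc x (vc y z h') h := by simp [vc]

theorem vc_mk_id {a b : B} {x : Arrow (a ⟶ b)} {f : a ⟶ b} (h : x.right = f) :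
    vc x (Arrow.mk (𝟙 f)) h = x := by
  subst h
  obtain ⟨f, g, η⟩ := x
  change Arrow.mk (η ≫ 𝟙 g ≫ 𝟙 g) = Arrow.mk η
  simp

theorem mk_id_vc {a b : B} {x : Arrow (a ⟶ b)} {f : a ⟶ b} (h : f = x.left) :
    vc (Arrow.mk (𝟙 f)) x h = x := by
  subst h
  obtain ⟨f, g, η⟩ := x
  change Arrow.mk (𝟙 f ≫ 𝟙 f ≫ η) = Arrow.mk η
  simp

theorem wl_vc {a b c : B} (f : a ⟶ b) (x y : Arrow (b ⟶ c)) (h : x.right = y.left) :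
    wl f (vc x y h) = vc (wl f x) (wl f y) (congrArg (f ≫ ·) h) := by
  obtain ⟨_, _, η⟩ := x
  obtain ⟨_, _, θ⟩ := y
  change Arrow.mk (f ◁ (η ≫ eqToHom _ ≫ θ)) = Arrow.mk (f ◁ η ≫ eqToHom _ ≫ f ◁ θ)
  simp

theorem wr_vc {a b c : B} (x y : Arrow (a ⟶ b)) (f : b ⟶ c) (h : x.right = y.left) :
    wr (vc x y h) f = vc (wr x f) (wr y f) (congrArg (· ≫ f) h) := by
  obtain ⟨_, _, η⟩ := x
  obtain ⟨_, _, θ⟩ := y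
  change Arrow.mk ((η ≫ eqToHom _ ≫ θ) ▷ f) = Arrow.mk (η ▷ f ≫ eqToHom _ ≫ θ ▷ f)
  simp

theorem wl_congr {a b c : B} {f f' : a ⟶ b} (h : f = f') {x x' : Arrow (b ⟶ c)} (hx : x = x') :
    wl f x = wl f' x' := by rw [h, hx]

theorem wl_mk_id {a b c : B} (f : a ⟶ b) (g : b ⟶ c) :
    wl f (Arrow.mk (𝟙 g)) = Arrow.mk (𝟙 (f ≫ g)) := by simp [wl]

theorem wr_mk_id {a b c : B} (f : a ⟶ b) (g : b ⟶ c) :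
    wr (Arrow.mk (𝟙 f)) g = Arrow.mk (𝟙 (f ≫ g)) := by simp [wr]

variable [Strict B]

theorem wl_id {a b : B} (x : Arrow (a ⟶ b)) : wl (𝟙 a) x = x := by
  obtain ⟨f, g, η⟩ := x
  change Arrow.mk (𝟙 a ◁ η) = Arrow.mk η
  simp [Strict.leftUnitor_eqToIso]

theorem wr_id {a b : B} (x : Arrow (a ⟶ b)) : wr x (𝟙 b) = x := by
  obtain ⟨f, g, η⟩ := x
  change Arrow.mk (η ▷ 𝟙 b) = Arrow.mk η
  simp [Strict.rightUnitor_eqToIso]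

theorem wl_comp {a b c d : B} (f : a ⟶ b) (g : b ⟶ c) (x : Arrow (c ⟶ d)) :
    wl (f ≫ g) x = wl f (wl g x) := by
  obtain ⟨_, _, η⟩ := x
  change Arrow.mk ((f ≫ g) ◁ η) = Arrow.mk (f ◁ g ◁ η)
  simp [Strict.associator_eqToIso]

theorem wr_comp {a b c d : B} (x : Arrow (a ⟶ b)) (f : b ⟶ c) (g : c ⟶ d) :
    wr x (f ≫ g) = wr (wr x f) g := by
  obtain ⟨_, _, η⟩ := x
  change Arrow.mk (η ▷ (f ≫ g)) = Arrow.mk (η ▷ f ▷ g)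
  simp [Strict.associator_eqToIso]

theorem wr_wl {a b c d : B} (f : a ⟶ b) (x : Arrow (b ⟶ c)) (g : c ⟶ d) :
    wr (wl f x) g = wl f (wr x g) := by
  obtain ⟨_, _, η⟩ := x
  change Arrow.mk ((f ◁ η) ▷ g) = Arrow.mk (f ◁ η ▷ g)
  simp [Strict.associator_eqToIso]

end Cells

/-! ### Comma objects, 2-pullbacks and representable 2-categories -/

section Limits

variable {C : Type u} [Bicategory.{w, v} C] [Strict C]

/-- A comma object of the opspan `r : A ⟶ D ⟵ B : s` in a strict 2-category. -/
structure CommaObject {A B D : C} (r : A ⟶ D) (s : B ⟶ D) where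
  /-- The vertex `r/s`. -/
  {pt : C}
  /-- The projection to `A`. -/
  d₀ : pt ⟶ A
  /-- The projection to `B`. -/
  d₁ : pt ⟶ B
  /-- The universal 2-cell. -/
  lam : d₀ ≫ r ⟶ d₁ ≫ s
  existsUnique_lift {S : C} (u₀ : S ⟶ A) (u₁ : S ⟶ B) (σ : u₀ ≫ r ⟶ u₁ ≫ s) :
    ∃! f : S ⟶ pt, ∃ (h₀ : f ≫ d₀ = u₀) (h₁ : f ≫ d₁ = u₁),
      σ = eqToHom (by rw [← h₀, Category.assoc]) ≫ f ◁ lam ≫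
        eqToHom (by rw [← h₁, Category.assoc])
  existsUnique_lift₂ {S : C} (f f' : S ⟶ pt) (ξ : f ≫ d₀ ⟶ f' ≫ d₀) (η : f ≫ d₁ ⟶ f' ≫ d₁)
    (h : ξ ▷ r ≫ (α_ f' d₀ r).hom ≫ f' ◁ lam =
      (α_ f d₀ r).hom ≫ f ◁ lam ≫ (α_ f d₁ s).inv ≫ η ▷ s ≫ (α_ f' d₁ s).hom) :
    ∃! φ : f ⟶ f', φ ▷ d₀ = ξ ∧ φ ▷ d₁ = η

/-- A square that is a 2-pullback in a strict 2-category: it is a pullback of 1-cells, and 2-cells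
into the vertex are uniquely determined by compatible pairs of 2-cells. -/
structure IsTwoPullback {P X Y Z : C} (fst : P ⟶ X) (snd : P ⟶ Y) (f : X ⟶ Z) (g : Y ⟶ Z) :
    Prop where
  isPullback : IsPullback fst snd f g
  existsUnique_lift₂ {S : C} (h h' : S ⟶ P) (ξ : h ≫ fst ⟶ h' ≫ fst) (η : h ≫ snd ⟶ h' ≫ snd)
    (w : ξ ▷ f = eqToHom (by rw [Category.assoc, isPullback.w, Category.assoc]) ≫ η ▷ g ≫
      eqToHom (by rw [Category.assoc, ← isPullback.w, Category.assoc])) :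
    ∃! φ : h ⟶ h', φ ▷ fst = ξ ∧ φ ▷ snd = η

/-- A strict 2-category is representable if it has 2-pullbacks and a comma object `Φ A` of the
identity opspan on each object `A`. -/
class Representable (C : Type u) [Bicategory.{w, v} C] [Strict C] : Prop where
  exists_comma (A : C) : Nonempty (CommaObject (𝟙 A) (𝟙 A))
  exists_pullback {X Y Z : C} (f : X ⟶ Z) (g : Y ⟶ Z) :
    ∃ (P : C) (fst : P ⟶ X) (snd : P ⟶ Y), IsTwoPullback fst snd f g

theorem comma_compat_iff {A B D P : C} {r : A ⟶ D} {s : B ⟶ D} {d₀ : P ⟶ A} {d₁ : P ⟶ B}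
    (lam : d₀ ≫ r ⟶ d₁ ≫ s) {S : C} {f f' : S ⟶ P} (ξ : f ≫ d₀ ⟶ f' ≫ d₀)
    (η : f ≫ d₁ ⟶ f' ≫ d₁) :
    ξ ▷ r ≫ (α_ f' d₀ r).hom ≫ f' ◁ lam =
      (α_ f d₀ r).hom ≫ f ◁ lam ≫ (α_ f d₁ s).inv ≫ η ▷ s ≫ (α_ f' d₁ s).hom ↔
    vc (wr (Arrow.mk ξ) r) (wl f' (Arrow.mk lam)) (Category.assoc f' d₀ r) =
      vc (wl f (Arrow.mk lam)) (wr (Arrow.mk η) s) (Category.assoc f d₁ s).symm := by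
  rw [← Arrow.mk_inj]
  simp only [Strict.associator_eqToIso, eqToIso.hom, eqToIso.inv, Arrow.arrow_mk_eqToHom_comp]
  have : ∀ (a : f ≫ d₀ ≫ r ⟶ f ≫ d₁ ≫ s), Arrow.mk (a ≫ eqToHom (Category.assoc f d₁ s).symm
      ≫ η ▷ s ≫ eqToHom (Category.assoc f' d₁ s)) =
      Arrow.mk (a ≫ eqToHom (Category.assoc f d₁ s).symm ≫ η ▷ s) := fun a =>
    mk_comp_congr rfl (mk_comp_congr rfl (by simp))
  rw [this]
  rfl

namespace CommaObject

variable {A B D : C} {r : A ⟶ D} {s : B ⟶ D} (K : CommaObject r s)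

/-- The 1-cell into a comma object induced by a span and a 2-cell. -/
noncomputable def lift {S : C} (u₀ : S ⟶ A) (u₁ : S ⟶ B) (σ : u₀ ≫ r ⟶ u₁ ≫ s) : S ⟶ K.pt :=
  (K.existsUnique_lift u₀ u₁ σ).choose

theorem lift_d₀ {S : C} (u₀ : S ⟶ A) (u₁ : S ⟶ B) (σ : u₀ ≫ r ⟶ u₁ ≫ s) :
    K.lift u₀ u₁ σ ≫ K.d₀ = u₀ :=
  (K.existsUnique_lift u₀ u₁ σ).choose_spec.1.1

theorem lift_d₁ {S : C} (u₀ : S ⟶ A) (u₁ : S ⟶ B) (σ : u₀ ≫ r ⟶ u₁ ≫ s) :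
    K.lift u₀ u₁ σ ≫ K.d₁ = u₁ :=
  (K.existsUnique_lift u₀ u₁ σ).choose_spec.1.2.1

theorem lift_lam {S : C} (u₀ : S ⟶ A) (u₁ : S ⟶ B) (σ : u₀ ≫ r ⟶ u₁ ≫ s) :
    wl (K.lift u₀ u₁ σ) (Arrow.mk K.lam) = Arrow.mk σ :=
  ((eq_conj_iff _ _ _ _).1 (K.existsUnique_lift u₀ u₁ σ).choose_spec.1.2.2).symm

theorem hom_ext {S : C} {f g : S ⟶ K.pt} (h₀ : f ≫ K.d₀ = g ≫ K.d₀) (h₁ : f ≫ K.d₁ = g ≫ K.d₁)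
    (h : wl f (Arrow.mk K.lam) = wl g (Arrow.mk K.lam)) : f = g := by
  refine (K.existsUnique_lift (g ≫ K.d₀) (g ≫ K.d₁)
    ((α_ _ _ _).hom ≫ g ◁ K.lam ≫ (α_ _ _ _).inv)).unique ⟨h₀, h₁, ?_⟩ ⟨rfl, rfl, ?_⟩
  · rw [eq_conj_iff]
    simpa [Strict.associator_eqToIso, mk_wl] using h.symm
  · rw [eq_conj_iff]
    simp [Strict.associator_eqToIso]

/-- The compatibility condition for inducing 2-cells, on unbundled 2-cells. -/
theorem compat_iff {S : C} {f f' : S ⟶ K.pt} (ξ : f ≫ K.d₀ ⟶ f' ≫ K.d₀)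
    (η : f ≫ K.d₁ ⟶ f' ≫ K.d₁) :
    ξ ▷ r ≫ (α_ f' K.d₀ r).hom ≫ f' ◁ K.lam =
      (α_ f K.d₀ r).hom ≫ f ◁ K.lam ≫ (α_ f K.d₁ s).inv ≫ η ▷ s ≫ (α_ f' K.d₁ s).hom ↔
    vc (wr (Arrow.mk ξ) r) (wl f' (Arrow.mk K.lam)) (Category.assoc f' K.d₀ r) =
      vc (wl f (Arrow.mk K.lam)) (wr (Arrow.mk η) s) (Category.assoc f K.d₁ s).symm :=
  comma_compat_iff K.lam ξ η

/-- The 2-cell into a comma object induced by a compatible pair of 2-cells. -/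
noncomputable def lift₂ {S : C} (f f' : S ⟶ K.pt) (ξ : f ≫ K.d₀ ⟶ f' ≫ K.d₀)
    (η : f ≫ K.d₁ ⟶ f' ≫ K.d₁)
    (h : vc (wr (Arrow.mk ξ) r) (wl f' (Arrow.mk K.lam)) (Category.assoc f' K.d₀ r) =
      vc (wl f (Arrow.mk K.lam)) (wr (Arrow.mk η) s) (Category.assoc f K.d₁ s).symm) : f ⟶ f' :=
  (K.existsUnique_lift₂ f f' ξ η ((K.compat_iff ξ η).2 h)).choose

theorem lift₂_d₀ {S : C} (f f' : S ⟶ K.pt) (ξ : f ≫ K.d₀ ⟶ f' ≫ K.d₀)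
    (η : f ≫ K.d₁ ⟶ f' ≫ K.d₁) (h) : K.lift₂ f f' ξ η h ▷ K.d₀ = ξ :=
  (K.existsUnique_lift₂ f f' ξ η ((K.compat_iff ξ η).2 h)).choose_spec.1.1

theorem lift₂_d₁ {S : C} (f f' : S ⟶ K.pt) (ξ : f ≫ K.d₀ ⟶ f' ≫ K.d₀)
    (η : f ≫ K.d₁ ⟶ f' ≫ K.d₁) (h) : K.lift₂ f f' ξ η h ▷ K.d₁ = η :=
  (K.existsUnique_lift₂ f f' ξ η ((K.compat_iff ξ η).2 h)).choose_spec.1.2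

theorem hom₂_ext {S : C} {f f' : S ⟶ K.pt} {φ φ' : f ⟶ f'}
    (h₀ : wr (Arrow.mk φ) K.d₀ = wr (Arrow.mk φ') K.d₀)
    (h₁ : wr (Arrow.mk φ) K.d₁ = wr (Arrow.mk φ') K.d₁) : φ = φ' := by
  have h₀' : φ ▷ K.d₀ = φ' ▷ K.d₀ := Arrow.mk_injective _ _ h₀
  have h₁' : φ ▷ K.d₁ = φ' ▷ K.d₁ := Arrow.mk_injective _ _ h₁
  refine (K.existsUnique_lift₂ f f' (φ' ▷ K.d₀) (φ' ▷ K.d₁) ?_).unique ⟨h₀', h₁'⟩ ⟨rfl, rfl⟩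
  rw [associator_naturality_left_assoc, ← whisker_exchange]
  simp

theorem arrow_ext {S : C} {x y : Arrow (S ⟶ K.pt)} (hl : x.left = y.left) (hr : x.right = y.right)
    (h₀ : wr x K.d₀ = wr y K.d₀) (h₁ : wr x K.d₁ = wr y K.d₁) : x = y := by
  obtain ⟨f, g, φ⟩ := x
  obtain ⟨f', g', φ'⟩ := y
  change f = f' at hl
  change g = g' at hr
  subst hl hr
  exact congrArg Arrow.mk (K.hom₂_ext h₀ h₁)

end CommaObject

end Limits

/-! ### 2-natural transformations and 2-monads -/

section TwoNat

variable {B : Type u₁} [Bicategory.{w₁, v₁} B] {C : Type u₂} [Bicategory.{w₂, v₂} C]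
  {D : Type u₃} [Bicategory.{w₃, v₃} D]

/-- A (strict) 2-natural transformation between 2-functors. -/
structure TwoNatTrans (F G : StrictPseudofunctor B C) where
  /-- The components. -/
  app (X : B) : F.obj X ⟶ G.obj X
  naturality {X Y : B} (f : X ⟶ Y) : F.map f ≫ app Y = app X ≫ G.map f
  naturality₂ {X Y : B} {f g : X ⟶ Y} (η : f ⟶ g) :
    F.map₂ η ▷ app Y = eqToHom (naturality f) ≫ app X ◁ G.map₂ η ≫ eqToHom (naturality g).symm

theorem mk_map₂_whiskerLeft (H : StrictPseudofunctor B C) {a b c : B} (f : a ⟶ b) {g h : b ⟶ c}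
    (η : g ⟶ h) : Arrow.mk (H.map₂ (f ◁ η)) = wl (H.map f) (Arrow.mk (H.map₂ η)) := by
  rw [H.map₂_whisker_left, H.mapComp_eq_eqToIso, H.mapComp_eq_eqToIso]
  simp [mk_wl]

theorem mk_map₂_whiskerRight (H : StrictPseudofunctor B C) {a b c : B} {g h : a ⟶ b}
    (η : g ⟶ h) (f : b ⟶ c) : Arrow.mk (H.map₂ (η ▷ f)) = wr (Arrow.mk (H.map₂ η)) (H.map f) := by
  rw [H.map₂_whisker_right, H.mapComp_eq_eqToIso, H.mapComp_eq_eqToIso]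
  simp [mk_wr]

theorem mk_map₂_congr (H : StrictPseudofunctor B C) {a b : B} {f g f' g' : a ⟶ b} {η : f ⟶ g}
    {η' : f' ⟶ g'} (h : Arrow.mk η = Arrow.mk η') :
    Arrow.mk (H.map₂ η) = Arrow.mk (H.map₂ η') := by
  obtain ⟨e₁, e₂, e₃⟩ := (Arrow.mk_eq_mk_iff _ _).1 h
  subst e₁ e₂ e₃
  simp

theorem TwoNatTrans.cell {F G : StrictPseudofunctor B C} (α : TwoNatTrans F G) {X Y : B}
    {f g : X ⟶ Y} (η : f ⟶ g) :
    wr (Arrow.mk (F.map₂ η)) (α.app Y) = wl (α.app X) (Arrow.mk (G.map₂ η)) :=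
  (eq_conj_iff _ _ _ _).1 (α.naturality₂ η)

/-- Post-composition of a 2-natural transformation with a 2-functor. -/
def TwoNatTrans.whiskerRight {F G : StrictPseudofunctor B C} (α : TwoNatTrans F G)
    (H : StrictPseudofunctor C D) : TwoNatTrans (F.comp H) (G.comp H) where
  app X := H.map (α.app X)
  naturality f := by
    change H.map _ ≫ H.map _ = H.map _ ≫ H.map _
    rw [← H.map_comp, ← H.map_comp, α.naturality]
  naturality₂ {X Y f g} η := by
    rw [eq_conj_iff]
    change wr (Arrow.mk (H.map₂ (F.map₂ η))) (H.map (α.app Y)) =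
      wl (H.map (α.app X)) (Arrow.mk (H.map₂ (G.map₂ η)))
    rw [← mk_map₂_whiskerLeft, ← mk_map₂_whiskerRight]
    exact mk_map₂_congr H (α.cell η)

/-- A 2-monad on a 2-category. -/
structure TwoMonad (B : Type u₁) [Bicategory.{w₁, v₁} B] where
  /-- The underlying 2-endofunctor. -/
  functor : StrictPseudofunctor B B
  /-- The unit. -/
  unit : TwoNatTrans (StrictPseudofunctor.id B) functor
  /-- The multiplication. -/
  mult : TwoNatTrans (functor.comp functor) functor
  assoc (X : B) : functor.map (mult.app X) ≫ mult.app X = mult.app (functor.obj X) ≫ mult.app X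
  left_unit (X : B) : unit.app (functor.obj X) ≫ mult.app X = 𝟙 (functor.obj X)
  right_unit (X : B) : functor.map (unit.app X) ≫ mult.app X = 𝟙 (functor.obj X)

/-- A 2-natural transformation `ψ : D₂T ⟶ TD₁` is a 2-transition from the 2-monad `D₁` to the
2-monad `D₂` along `T` if it is compatible with the units and the multiplications. -/
structure IsTwoTransition (D₁ : TwoMonad B) (D₂ : TwoMonad C) (T : StrictPseudofunctor B C)
    (ψ : TwoNatTrans (T.comp D₂.functor) (D₁.functor.comp T)) : Prop where
  unit (X : B) : D₂.unit.app (T.obj X) ≫ ψ.app X = T.map (D₁.unit.app X)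
  mult (X : B) : D₂.mult.app (T.obj X) ≫ ψ.app X =
    D₂.functor.map (ψ.app X) ≫ ψ.app (D₁.functor.obj X) ≫ T.map (D₁.mult.app X)

end TwoNat

/-! ### The arrow 2-category -/

section ArrowCategory

/-- An object of the arrow 2-category: a bundle, that is, an arbitrary 1-cell `total ⟶ base`. -/
structure Arr (C : Type u) [Bicategory.{w, v} C] where
  /-- The domain of the bundle. -/
  {total : C}
  /-- The codomain of the bundle. -/
  {base : C}
  /-- The bundle itself. -/
  proj : total ⟶ base

variable {C : Type u} [Bicategory.{w, v} C]

/-- A 1-cell of the arrow 2-category: a commutative square with an upstairs and a downstairs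
part. -/
@[ext]
structure Arr.Hom (p q : Arr C) where
  /-- The upstairs part. -/
  up : p.total ⟶ q.total
  /-- The downstairs part. -/
  down : p.base ⟶ q.base
  w : up ≫ q.proj = p.proj ≫ down

/-- A 2-cell of the arrow 2-category: a pair of 2-cells `up` and `down` with
`q up = down p`. -/
@[ext]
structure Arr.Hom₂ {p q : Arr C} (f g : Arr.Hom p q) where
  /-- The upstairs part. -/
  up : f.up ⟶ g.up
  /-- The downstairs part. -/
  down : f.down ⟶ g.down
  w : up ▷ q.proj = eqToHom f.w ≫ p.proj ◁ down ≫ eqToHom g.w.symm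

theorem Arr.Hom₂.cell {p q : Arr C} {f g : Arr.Hom p q} (α : Arr.Hom₂ f g) :
    wr (Arrow.mk α.up) q.proj = wl p.proj (Arrow.mk α.down) :=
  (eq_conj_iff _ _ _ _).1 α.w

variable [Strict C]

instance : CategoryStruct (Arr C) where
  Hom p q := Arr.Hom p q
  id p := ⟨𝟙 _, 𝟙 _, by rw [Category.id_comp, Category.comp_id]⟩
  comp {p q r} f g := ⟨f.up ≫ g.up, f.down ≫ g.down, by
    rw [Category.assoc, g.w, ← Category.assoc, f.w, Category.assoc]⟩

instance (p q : Arr C) : Category (p ⟶ q) where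
  Hom f g := Arr.Hom₂ f g
  id f := ⟨𝟙 _, 𝟙 _, by simp⟩
  comp {f g h} α β := ⟨α.up ≫ β.up, α.down ≫ β.down, by simp [α.w, β.w]⟩
  id_comp α := by ext <;> simp
  comp_id _ := by ext <;> simp
  assoc _ _ _ := by ext <;> simp

@[simp] theorem Arr.id_up (p : Arr C) : Arr.Hom.up (𝟙 p) = 𝟙 p.total := rfl
@[simp] theorem Arr.id_down (p : Arr C) : Arr.Hom.down (𝟙 p) = 𝟙 p.base := rfl
@[simp] theorem Arr.comp_up {p q r : Arr C} (f : p ⟶ q) (g : q ⟶ r) :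
    Arr.Hom.up (f ≫ g) = f.up ≫ g.up := rfl
@[simp] theorem Arr.comp_down {p q r : Arr C} (f : p ⟶ q) (g : q ⟶ r) :
    Arr.Hom.down (f ≫ g) = f.down ≫ g.down := rfl
@[simp] theorem Arr.id₂_up {p q : Arr C} (f : p ⟶ q) : Arr.Hom₂.up (𝟙 f) = 𝟙 f.up := rfl
@[simp] theorem Arr.id₂_down {p q : Arr C} (f : p ⟶ q) : Arr.Hom₂.down (𝟙 f) = 𝟙 f.down := rfl
@[simp] theorem Arr.comp₂_up {p q : Arr C} {f g h : p ⟶ q} (α : f ⟶ g) (β : g ⟶ h) :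
    Arr.Hom₂.up (α ≫ β) = α.up ≫ β.up := rfl
@[simp] theorem Arr.comp₂_down {p q : Arr C} {f g h : p ⟶ q} (α : f ⟶ g) (β : g ⟶ h) :
    Arr.Hom₂.down (α ≫ β) = α.down ≫ β.down := rfl

@[ext] theorem Arr.hom_ext {p q : Arr C} {f g : p ⟶ q} (h : f.up = g.up)
    (h' : f.down = g.down) : f = g := Arr.Hom.ext h h'

@[ext] theorem Arr.hom₂_ext {p q : Arr C} {f g : p ⟶ q} {α β : f ⟶ g} (h : α.up = β.up)
    (h' : α.down = β.down) : α = β := Arr.Hom₂.ext h h'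

@[simp] theorem Arr.eqToHom_up {p q : Arr C} {f g : p ⟶ q} (h : f = g) :
    Arr.Hom₂.up (eqToHom h) = eqToHom (congrArg Arr.Hom.up h) := by subst h; rfl
@[simp] theorem Arr.eqToHom_down {p q : Arr C} {f g : p ⟶ q} (h : f = g) :
    Arr.Hom₂.down (eqToHom h) = eqToHom (congrArg Arr.Hom.down h) := by subst h; rfl

theorem Arr.eq_conj {p q : Arr C} {f g f' g' : p ⟶ q} (η : f ⟶ g) (θ : f' ⟶ g') (h : f = f')
    (h' : g' = g) (hu : Arrow.mk η.up = Arrow.mk θ.up) (hd : Arrow.mk η.down = Arrow.mk θ.down) :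
    η = eqToHom h ≫ θ ≫ eqToHom h' := by
  subst h h'
  rw [eqToHom_refl, eqToHom_refl, Category.comp_id, Category.id_comp]
  exact Arr.hom₂_ext (Arrow.mk_injective _ _ hu) (Arrow.mk_injective _ _ hd)

theorem Arr.comp_id' {p q : Arr C} (f : p ⟶ q) : f ≫ 𝟙 q = f := by ext <;> simp
theorem Arr.id_comp' {p q : Arr C} (f : p ⟶ q) : 𝟙 p ≫ f = f := by ext <;> simp
theorem Arr.assoc' {p q r s : Arr C} (f : p ⟶ q) (g : q ⟶ r) (h : r ⟶ s) :
    (f ≫ g) ≫ h = f ≫ g ≫ h := by ext <;> simp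

/-- Left whiskering in the arrow 2-category. -/
def Arr.whiskerL {p q r : Arr C} (f : p ⟶ q) {g h : q ⟶ r} (η : g ⟶ h) : f ≫ g ⟶ f ≫ h :=
  Arr.Hom₂.mk (f.up ◁ η.up) (f.down ◁ η.down) (by
    refine (eq_conj_iff _ _ _ _).2 ?_
    change wr (wl f.up (Arrow.mk η.up)) r.proj = wl p.proj (wl f.down (Arrow.mk η.down))
    rw [wr_wl, η.cell, ← wl_comp, f.w, ← wl_comp])

/-- Right whiskering in the arrow 2-category. -/
def Arr.whiskerR {p q r : Arr C} {f g : p ⟶ q} (η : f ⟶ g) (h : q ⟶ r) : f ≫ h ⟶ g ≫ h :=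
  Arr.Hom₂.mk (η.up ▷ h.up) (η.down ▷ h.down) (by
    refine (eq_conj_iff _ _ _ _).2 ?_
    change wr (wr (Arrow.mk η.up) h.up) r.proj = wl p.proj (wr (Arrow.mk η.down) h.down)
    rw [← wr_comp, h.w, wr_comp, η.cell, wr_wl])

@[simp] theorem Arr.whiskerL_up {p q r : Arr C} (f : p ⟶ q) {g h : q ⟶ r} (η : g ⟶ h) :
    Arr.Hom₂.up (Arr.whiskerL f η) = f.up ◁ η.up := rfl
@[simp] theorem Arr.whiskerL_down {p q r : Arr C} (f : p ⟶ q) {g h : q ⟶ r} (η : g ⟶ h) :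
    Arr.Hom₂.down (Arr.whiskerL f η) = f.down ◁ η.down := rfl
@[simp] theorem Arr.whiskerR_up {p q r : Arr C} {f g : p ⟶ q} (η : f ⟶ g) (h : q ⟶ r) :
    Arr.Hom₂.up (Arr.whiskerR η h) = η.up ▷ h.up := rfl
@[simp] theorem Arr.whiskerR_down {p q r : Arr C} {f g : p ⟶ q} (η : f ⟶ g) (h : q ⟶ r) :
    Arr.Hom₂.down (Arr.whiskerR η h) = η.down ▷ h.down := rfl

/-- The arrow 2-category: all the structure is computed upstairs and downstairs. -/
instance : Bicategory (Arr C) where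
  whiskerLeft {p q r} f g h η := Arr.whiskerL f η
  whiskerRight {p q r} f g η h := Arr.whiskerR η h
  associator f g h := eqToIso (Arr.assoc' f g h)
  leftUnitor f := eqToIso (Arr.id_comp' f)
  rightUnitor f := eqToIso (Arr.comp_id' f)
  whiskerLeft_id _ _ := by ext <;> simp
  whiskerLeft_comp _ _ _ _ _ _ := by ext <;> simp
  id_whiskerLeft _ := by ext <;> simp [Strict.leftUnitor_eqToIso]
  comp_whiskerLeft _ _ _ _ _ := by ext <;> simp [Strict.associator_eqToIso]
  id_whiskerRight _ _ := by ext <;> simp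
  comp_whiskerRight _ _ _ := by ext <;> simp
  whiskerRight_id _ := by ext <;> simp [Strict.rightUnitor_eqToIso]
  whiskerRight_comp _ _ _ := by ext <;> simp [Strict.associator_eqToIso]
  whisker_assoc _ _ _ _ _ := by ext <;> simp [Strict.associator_eqToIso]
  whisker_exchange _ _ := by ext <;> simp [whisker_exchange]
  pentagon _ _ _ _ := by ext <;> simp
  triangle _ _ := by ext <;> simp

instance : Strict (Arr C) where
  id_comp := Arr.id_comp'
  comp_id := Arr.comp_id'
  assoc := Arr.assoc'

@[simp] theorem Arr.whiskerLeft_up {p q r : Arr C} (f : p ⟶ q) {g h : q ⟶ r} (η : g ⟶ h) :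
    Arr.Hom₂.up (f ◁ η) = f.up ◁ η.up := rfl
@[simp] theorem Arr.whiskerLeft_down {p q r : Arr C} (f : p ⟶ q) {g h : q ⟶ r} (η : g ⟶ h) :
    Arr.Hom₂.down (f ◁ η) = f.down ◁ η.down := rfl
@[simp] theorem Arr.whiskerRight_up {p q r : Arr C} {f g : p ⟶ q} (η : f ⟶ g) (h : q ⟶ r) :
    Arr.Hom₂.up (η ▷ h) = η.up ▷ h.up := rfl
@[simp] theorem Arr.whiskerRight_down {p q r : Arr C} {f g : p ⟶ q} (η : f ⟶ g) (h : q ⟶ r) :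
    Arr.Hom₂.down (η ▷ h) = η.down ▷ h.down := rfl

variable (C)

/-- The 2-functor `dom : Arr C ⥤ C`. -/
def dom : StrictPseudofunctor (Arr C) C := StrictPseudofunctor.mk''
  { obj := fun p => p.total
    map := fun f => f.up
    map₂ := fun α => α.up
    map_id := fun _ => rfl
    map_comp := fun _ _ => rfl }

/-- The 2-functor `cod : Arr C ⥤ C`. -/
def cod : StrictPseudofunctor (Arr C) C := StrictPseudofunctor.mk''
  { obj := fun p => p.base
    map := fun f => f.down
    map₂ := fun α => α.down
    map_id := fun _ => rfl
    map_comp := fun _ _ => rfl }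

/-- The 2-functor `C ⥤ Arr C` sending `B` to the identity bundle on `B`. -/
def idBundle : StrictPseudofunctor C (Arr C) := StrictPseudofunctor.mk''
  { obj := fun B => ⟨𝟙 B⟩
    map := fun f => ⟨f, f, by rw [Category.comp_id, Category.id_comp]⟩
    map₂ := fun α => ⟨α, α, by
      rw [eq_conj_iff, mk_wr, mk_wl, wl_id, wr_id]⟩
    map_id := fun _ => rfl
    map_comp := fun _ _ => rfl }

/-- The 2-natural transformation `Id ⟶ idBundle ∘ cod` whose component at a bundle `p` over `B` is
the square `(p, 𝟙 B)`. -/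
def toIdBundle : TwoNatTrans (StrictPseudofunctor.id (Arr C)) ((cod C).comp (idBundle C)) where
  app p := ⟨p.proj, 𝟙 p.base, rfl⟩
  naturality {p q} f := by
    apply Arr.hom_ext
    · exact f.w
    · exact (Category.comp_id f.down).trans (Category.id_comp f.down).symm
  naturality₂ {p q f g} α := by
    apply Arr.hom₂_ext
    · simp only [Arr.comp₂_up, Arr.eqToHom_up]
      exact α.w
    · simp only [Arr.comp₂_down, Arr.eqToHom_down]
      rw [eq_conj_iff]
      exact (wr_id (Arrow.mk α.down)).trans (wl_id (Arrow.mk α.down)).symm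

variable {C}

/-- A 2-natural transformation between 2-functors `D ⥤ C` is the same thing as a 2-functor
`D ⥤ Arr C`. -/
def TwoNatTrans.toArr {D : Type u₁} [Bicategory.{w₁, v₁} D] [Strict D] {F G : StrictPseudofunctor D C}
    (α : TwoNatTrans F G) : StrictPseudofunctor D (Arr C) := StrictPseudofunctor.mk''
  { obj := fun X => ⟨α.app X⟩
    map := fun f => ⟨F.map f, G.map f, α.naturality f⟩
    map₂ := fun η => ⟨F.map₂ η, G.map₂ η, α.naturality₂ η⟩
    map₂_id := fun f => by ext <;> simp
    map₂_comp := fun f g => by ext <;> simp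
    map_id := fun X => by ext; exacts [F.map_id X, G.map_id X]
    map_comp := fun f g => by ext; exacts [F.map_comp f g, G.map_comp f g]
    map₂_whisker_left := fun f _ _ η => by
      ext <;> simp [StrictPseudofunctor.mapComp_eq_eqToIso]
    map₂_whisker_right := fun η f => by
      ext <;> simp [StrictPseudofunctor.mapComp_eq_eqToIso] }

end ArrowCategory

/-! ### The 2-monad `L` on the arrow 2-category -/

section Monad

variable {C : Type u} [Bicategory.{w, v} C] [Strict C]

/-- A choice of comma objects `p/B` for all bundles `p : E ⟶ B`. -/
abbrev CommaChoice (C : Type u) [Bicategory.{w, v} C] [Strict C] :=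
  ∀ p : Arr C, CommaObject p.proj (𝟙 p.base)

variable (κ : CommaChoice C)

/-- The upstairs part of `L f`. -/
noncomputable def LmapUp {p q : Arr C} (f : p ⟶ q) : (κ p).pt ⟶ (κ q).pt :=
  (κ q).lift ((κ p).d₀ ≫ f.up) ((κ p).d₁ ≫ f.down)
    (eqToHom (by rw [Category.assoc, f.w, Category.assoc]) ≫ (κ p).lam ▷ f.down ≫
      eqToHom (by simp only [Category.comp_id]))

theorem LmapUp_d₀ {p q : Arr C} (f : p ⟶ q) : LmapUp κ f ≫ (κ q).d₀ = (κ p).d₀ ≫ f.up :=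
  (κ q).lift_d₀ _ _ _

theorem LmapUp_d₁ {p q : Arr C} (f : p ⟶ q) : LmapUp κ f ≫ (κ q).d₁ = (κ p).d₁ ≫ f.down :=
  (κ q).lift_d₁ _ _ _

theorem LmapUp_lam {p q : Arr C} (f : p ⟶ q) :
    wl (LmapUp κ f) (Arrow.mk (κ q).lam) = wr (Arrow.mk (κ p).lam) f.down := by
  refine ((κ q).lift_lam _ _ _).trans ?_
  rw [Arrow.arrow_mk_eqToHom_comp, Arrow.arrow_mk_comp_eqToHom]
  rfl

theorem LmapUp₂_compat {p q : Arr C} {f g : p ⟶ q} (α : f ⟶ g) :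
    vc (wr (Arrow.mk (eqToHom (LmapUp_d₀ κ f) ≫ (κ p).d₀ ◁ α.up ≫
          eqToHom (LmapUp_d₀ κ g).symm)) q.proj)
        (wl (LmapUp κ g) (Arrow.mk (κ q).lam)) (Category.assoc _ _ _) =
      vc (wl (LmapUp κ f) (Arrow.mk (κ q).lam))
        (wr (Arrow.mk (eqToHom (LmapUp_d₁ κ f) ≫ (κ p).d₁ ◁ α.down ≫
          eqToHom (LmapUp_d₁ κ g).symm)) (𝟙 q.base)) (Category.assoc _ _ _).symm := by
  have e : Arrow.mk (((κ p).d₀ ≫ p.proj) ◁ α.down ≫ (κ p).lam ▷ g.down) =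
      Arrow.mk ((κ p).lam ▷ f.down ≫ ((κ p).d₁ ≫ 𝟙 p.base) ◁ α.down) := by
    rw [whisker_exchange]
  rw [mk_comp, mk_comp] at e
  refine Eq.trans (vc_congr ?_ (LmapUp_lam κ g) _) (e.trans (vc_congr ?_ ?_ _))
  · rw [Arrow.arrow_mk_eqToHom_comp, Arrow.arrow_mk_comp_eqToHom, mk_wl, wr_wl, α.cell,
      mk_wl, wl_comp]
  · exact (LmapUp_lam κ f).symm
  · rw [Arrow.arrow_mk_eqToHom_comp, Arrow.arrow_mk_comp_eqToHom, mk_wl, wl_comp, wl_id,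
      wr_id, mk_wl]

/-- The upstairs part of `L α`. -/
noncomputable def LmapUp₂ {p q : Arr C} {f g : p ⟶ q} (α : f ⟶ g) : LmapUp κ f ⟶ LmapUp κ g :=
  (κ q).lift₂ _ _
    (eqToHom (LmapUp_d₀ κ f) ≫ (κ p).d₀ ◁ α.up ≫ eqToHom (LmapUp_d₀ κ g).symm)
    (eqToHom (LmapUp_d₁ κ f) ≫ (κ p).d₁ ◁ α.down ≫ eqToHom (LmapUp_d₁ κ g).symm)
    (LmapUp₂_compat κ α)

theorem LmapUp₂_d₀ {p q : Arr C} {f g : p ⟶ q} (α : f ⟶ g) :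
    wr (Arrow.mk (LmapUp₂ κ α)) (κ q).d₀ = wl (κ p).d₀ (Arrow.mk α.up) := by
  refine (congrArg Arrow.mk ((κ q).lift₂_d₀ _ _ _ _ (LmapUp₂_compat κ α))).trans ?_
  rw [Arrow.arrow_mk_eqToHom_comp, Arrow.arrow_mk_comp_eqToHom]
  rfl

theorem LmapUp₂_d₁ {p q : Arr C} {f g : p ⟶ q} (α : f ⟶ g) :
    wr (Arrow.mk (LmapUp₂ κ α)) (κ q).d₁ = wl (κ p).d₁ (Arrow.mk α.down) := by
  refine (congrArg Arrow.mk ((κ q).lift₂_d₁ _ _ _ _ (LmapUp₂_compat κ α))).trans ?_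
  rw [Arrow.arrow_mk_eqToHom_comp, Arrow.arrow_mk_comp_eqToHom]
  rfl

/-- The 2-endofunctor `L` of the arrow 2-category: it sends a bundle `p : E ⟶ B` to
`d₁ : p/B ⟶ B`. -/
noncomputable def L : StrictPseudofunctor (Arr C) (Arr C) := StrictPseudofunctor.mk''
  { obj := fun p => ⟨(κ p).d₁⟩
    map := fun f => Arr.Hom.mk (LmapUp κ f) f.down (LmapUp_d₁ κ f)
    map₂ := fun α => Arr.Hom₂.mk (LmapUp₂ κ α) α.down
      ((eq_conj_iff _ _ _ _).2 (LmapUp₂_d₁ κ α))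
    map₂_id := fun {p q} f => by
      refine Arr.hom₂_ext ((κ q).hom₂_ext ?_ ?_) rfl
      · exact (LmapUp₂_d₀ κ (𝟙 f)).trans ((wl_mk_id _ _).trans (by
          rw [← LmapUp_d₀]; exact (wr_mk_id _ _).symm))
      · exact (LmapUp₂_d₁ κ (𝟙 f)).trans ((wl_mk_id _ _).trans (by
          rw [← LmapUp_d₁]; exact (wr_mk_id _ _).symm))
    map₂_comp := fun {p q f g h} α β => by
      refine Arr.hom₂_ext ((κ q).hom₂_ext ?_ ?_) rfl
      · refine (LmapUp₂_d₀ κ (α ≫ β)).trans ?_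
        change _ = wr (Arrow.mk (LmapUp₂ κ α ≫ LmapUp₂ κ β)) _
        rw [Arr.comp₂_up, mk_comp, mk_comp, wl_vc, wr_vc]
        exact vc_congr (LmapUp₂_d₀ κ α).symm (LmapUp₂_d₀ κ β).symm _
      · refine (LmapUp₂_d₁ κ (α ≫ β)).trans ?_
        change _ = wr (Arrow.mk (LmapUp₂ κ α ≫ LmapUp₂ κ β)) _
        rw [Arr.comp₂_down, mk_comp, mk_comp, wl_vc, wr_vc]
        exact vc_congr (LmapUp₂_d₁ κ α).symm (LmapUp₂_d₁ κ β).symm _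
    map_id := fun p => by
      refine Arr.hom_ext ((κ p).hom_ext ?_ ?_ ?_) rfl
      · exact (LmapUp_d₀ κ (𝟙 p)).trans ((Category.comp_id _).trans (Category.id_comp _).symm)
      · exact (LmapUp_d₁ κ (𝟙 p)).trans ((Category.comp_id _).trans (Category.id_comp _).symm)
      · exact (LmapUp_lam κ (𝟙 p)).trans ((wr_id _).trans (wl_id _).symm)
    map_comp := fun {p q r} f g => by
      refine Arr.hom_ext ((κ r).hom_ext ?_ ?_ ?_) rfl
      · change LmapUp κ (f ≫ g) ≫ _ = (LmapUp κ f ≫ LmapUp κ g) ≫ _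
        rw [LmapUp_d₀, Category.assoc, LmapUp_d₀, ← Category.assoc, LmapUp_d₀, Category.assoc,
          Arr.comp_up]
      · change LmapUp κ (f ≫ g) ≫ _ = (LmapUp κ f ≫ LmapUp κ g) ≫ _
        rw [LmapUp_d₁, Category.assoc, LmapUp_d₁, ← Category.assoc, LmapUp_d₁, Category.assoc,
          Arr.comp_down]
      · change wl (LmapUp κ (f ≫ g)) _ = wl (LmapUp κ f ≫ LmapUp κ g) _
        rw [LmapUp_lam, wl_comp, LmapUp_lam, ← wr_wl, LmapUp_lam, ← wr_comp, Arr.comp_down]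
    map₂_whisker_left := fun {p q r} f {g g'} η => by
      refine Arr.hom₂_ext ((κ r).hom₂_ext ?_ ?_) ?_
      · refine (LmapUp₂_d₀ κ (f ◁ η)).trans ?_
        simp only [Arr.comp₂_up, Arr.eqToHom_up, Arrow.arrow_mk_eqToHom_comp,
          Arrow.arrow_mk_comp_eqToHom]
        change wl (κ p).d₀ (wl f.up (Arrow.mk η.up)) = wr (wl (LmapUp κ f) (Arrow.mk (LmapUp₂ κ η))) _
        rw [wr_wl, LmapUp₂_d₀, ← wl_comp, ← wl_comp, LmapUp_d₀]
      · refine (LmapUp₂_d₁ κ (f ◁ η)).trans ?_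
        simp only [Arr.comp₂_up, Arr.eqToHom_up, Arrow.arrow_mk_eqToHom_comp,
          Arrow.arrow_mk_comp_eqToHom]
        change wl (κ p).d₁ (wl f.down (Arrow.mk η.down)) =
          wr (wl (LmapUp κ f) (Arrow.mk (LmapUp₂ κ η))) _
        rw [wr_wl, LmapUp₂_d₁, ← wl_comp, ← wl_comp, LmapUp_d₁]
      · simp
    map₂_whisker_right := fun {p q r f f'} η g => by
      refine Arr.hom₂_ext ((κ r).hom₂_ext ?_ ?_) ?_
      · refine (LmapUp₂_d₀ κ (η ▷ g)).trans ?_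
        simp only [Arr.comp₂_up, Arr.eqToHom_up, Arrow.arrow_mk_eqToHom_comp,
          Arrow.arrow_mk_comp_eqToHom]
        change wl (κ p).d₀ (wr (Arrow.mk η.up) g.up) = wr (wr (Arrow.mk (LmapUp₂ κ η)) (LmapUp κ g)) _
        rw [← wr_comp, LmapUp_d₀, wr_comp, LmapUp₂_d₀, wr_wl]
      · refine (LmapUp₂_d₁ κ (η ▷ g)).trans ?_
        simp only [Arr.comp₂_up, Arr.eqToHom_up, Arrow.arrow_mk_eqToHom_comp,
          Arrow.arrow_mk_comp_eqToHom]
        change wl (κ p).d₁ (wr (Arrow.mk η.down) g.down) =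
          wr (wr (Arrow.mk (LmapUp₂ κ η)) (LmapUp κ g)) _
        rw [← wr_comp, LmapUp_d₁, wr_comp, LmapUp₂_d₁, wr_wl]
      · simp }

theorem L_map_up {p q : Arr C} (f : p ⟶ q) : Arr.Hom.up ((L κ).map f) = LmapUp κ f := rfl
theorem L_map_down {p q : Arr C} (f : p ⟶ q) : Arr.Hom.down ((L κ).map f) = f.down := rfl

/-- The 2-natural transformation `d₀ : dom L ⟶ dom`. -/
noncomputable def d₀ : TwoNatTrans ((L κ).comp (dom C)) (dom C) where
  app p := (κ p).d₀
  naturality f := LmapUp_d₀ κ f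
  naturality₂ α := (eq_conj_iff _ _ _ _).2 (LmapUp₂_d₀ κ α)

/-- The value of `L` on objects. -/
abbrev Lobj (p : Arr C) : Arr C := ⟨(κ p).d₁⟩

/-- The value of `L` on 1-cells. -/
noncomputable abbrev Lmap {p q : Arr C} (f : p ⟶ q) : Lobj κ p ⟶ Lobj κ q :=
  Arr.Hom.mk (LmapUp κ f) f.down (LmapUp_d₁ κ f)

/-- The value of `L` on 2-cells. -/
noncomputable abbrev Lmap₂ {p q : Arr C} {f g : p ⟶ q} (α : f ⟶ g) : Lmap κ f ⟶ Lmap κ g :=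
  Arr.Hom₂.mk (LmapUp₂ κ α) α.down ((eq_conj_iff _ _ _ _).2 (LmapUp₂_d₁ κ α))

/-- The 1-cell `E ⟶ p/B` corresponding to the identity 2-cell of `p`. -/
noncomputable def unitUp (p : Arr C) : p.total ⟶ (κ p).pt :=
  (κ p).lift (𝟙 _) p.proj (eqToHom (by rw [Category.comp_id, Category.id_comp]))

theorem unitUp_d₀ (p : Arr C) : unitUp κ p ≫ (κ p).d₀ = 𝟙 _ := (κ p).lift_d₀ _ _ _
theorem unitUp_d₁ (p : Arr C) : unitUp κ p ≫ (κ p).d₁ = p.proj := (κ p).lift_d₁ _ _ _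
theorem unitUp_lam (p : Arr C) : wl (unitUp κ p) (Arrow.mk (κ p).lam) = Arrow.mk (𝟙 p.proj) := by
  refine ((κ p).lift_lam _ _ _).trans ?_
  rw [mk_eqToHom, Category.id_comp]

theorem unitUp_naturality {p q : Arr C} (f : p ⟶ q) :
    f.up ≫ unitUp κ q = unitUp κ p ≫ LmapUp κ f := by
  refine (κ q).hom_ext ?_ ?_ ?_
  · rw [Category.assoc, unitUp_d₀, Category.assoc, LmapUp_d₀, ← Category.assoc, unitUp_d₀,
      Category.comp_id, Category.id_comp]
  · rw [Category.assoc, unitUp_d₁, Category.assoc, LmapUp_d₁, ← Category.assoc, unitUp_d₁, f.w]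
  · rw [wl_comp, unitUp_lam, wl_comp, LmapUp_lam, ← wr_wl, unitUp_lam, wl_mk_id, wr_mk_id, f.w]

theorem unitUp_naturality₂ {p q : Arr C} {f g : p ⟶ q} (α : f ⟶ g) :
    wr (Arrow.mk α.up) (unitUp κ q) = wl (unitUp κ p) (Arrow.mk (LmapUp₂ κ α)) := by
  refine (κ q).arrow_ext (unitUp_naturality κ f) (unitUp_naturality κ g) ?_ ?_
  · rw [← wr_comp, unitUp_d₀, wr_wl, LmapUp₂_d₀, ← wl_comp, unitUp_d₀, wr_id, wl_id]
  · rw [← wr_comp, unitUp_d₁, wr_wl, LmapUp₂_d₁, ← wl_comp, unitUp_d₁, α.cell]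

theorem id_down_naturality {p q : Arr C} (f : p ⟶ q) :
    f.down ≫ 𝟙 q.base = 𝟙 p.base ≫ f.down :=
  (Category.comp_id f.down).trans (Category.id_comp f.down).symm

theorem id_down_naturality₂ {p q : Arr C} {f g : p ⟶ q} (α : f ⟶ g) :
    wr (Arrow.mk α.down) (𝟙 q.base) = wl (𝟙 p.base) (Arrow.mk α.down) :=
  (wr_id (Arrow.mk α.down)).trans (wl_id (Arrow.mk α.down)).symm

/-- The unit `i : Id ⟶ L`. -/
noncomputable def Lunit : TwoNatTrans (StrictPseudofunctor.id (Arr C)) (L κ) where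
  app p := Arr.Hom.mk (unitUp κ p) (𝟙 _) ((unitUp_d₁ κ p).trans (Category.comp_id _).symm)
  naturality f := Arr.hom_ext (unitUp_naturality κ f) (id_down_naturality f)
  naturality₂ α := Arr.eq_conj _ _ _ _ (unitUp_naturality₂ κ α) (id_down_naturality₂ α)

theorem mult_boundary (p : Arr C) :
    (κ (Lobj κ p)).d₀ ≫ (κ p).d₁ ≫ 𝟙 p.base = (κ (Lobj κ p)).d₀ ≫ (κ p).d₁ :=
  congrArg (_ ≫ ·) (Category.comp_id _)

/-- The 1-cell `d₁/B ⟶ p/B`, where `d₁ : p/B ⟶ B`, corresponding to the composite of the two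
universal 2-cells. -/
noncomputable def multUp (p : Arr C) : (κ (Lobj κ p)).pt ⟶ (κ p).pt :=
  (κ p).lift ((κ (Lobj κ p)).d₀ ≫ (κ p).d₀) (κ (Lobj κ p)).d₁
    (eqToHom (Category.assoc _ _ _) ≫ (κ (Lobj κ p)).d₀ ◁ (κ p).lam ≫
      eqToHom (mult_boundary κ p) ≫ (κ (Lobj κ p)).lam)

theorem multUp_d₀ (p : Arr C) : multUp κ p ≫ (κ p).d₀ = (κ (Lobj κ p)).d₀ ≫ (κ p).d₀ :=
  (κ p).lift_d₀ _ _ _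
theorem multUp_d₁ (p : Arr C) : multUp κ p ≫ (κ p).d₁ = (κ (Lobj κ p)).d₁ :=
  (κ p).lift_d₁ _ _ _
theorem multUp_lam (p : Arr C) : wl (multUp κ p) (Arrow.mk (κ p).lam) =
    vc (wl (κ (Lobj κ p)).d₀ (Arrow.mk (κ p).lam)) (Arrow.mk (κ (Lobj κ p)).lam)
      (mult_boundary κ p) := by
  refine ((κ p).lift_lam _ _ _).trans ?_
  rw [Arrow.arrow_mk_eqToHom_comp]
  rfl

theorem wl_multUp_lam (p : Arr C) {S : C} (g : S ⟶ (κ (Lobj κ p)).pt) :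
    wl (g ≫ multUp κ p) (Arrow.mk (κ p).lam) =
      vc (wl (g ≫ (κ (Lobj κ p)).d₀) (Arrow.mk (κ p).lam)) (wl g (Arrow.mk (κ (Lobj κ p)).lam))
        ((Category.assoc _ _ _).trans (congrArg (g ≫ ·) (mult_boundary κ p))) := by
  rw [wl_comp]
  refine (congrArg (wl g) (multUp_lam κ p)).trans ((wl_vc _ _ _ _).trans ?_)
  exact vc_congr (wl_comp _ _ _).symm rfl _

theorem wr_multUp_lam (p : Arr C) {S : C} (g : p.base ⟶ S) :
    wr (wl (multUp κ p) (Arrow.mk (κ p).lam)) g =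
      vc (wr (wl (κ (Lobj κ p)).d₀ (Arrow.mk (κ p).lam)) g) (wr (Arrow.mk (κ (Lobj κ p)).lam) g)
        (congrArg (· ≫ g) (mult_boundary κ p)) :=
  (congrArg (wr · g) (multUp_lam κ p)).trans (wr_vc _ _ _ _)

theorem multUp_naturality {p q : Arr C} (f : p ⟶ q) :
    LmapUp κ (Lmap κ f) ≫ multUp κ q = multUp κ p ≫ LmapUp κ f := by
  have e : LmapUp κ (Lmap κ f) ≫ (κ (Lobj κ q)).d₀ = (κ (Lobj κ p)).d₀ ≫ LmapUp κ f :=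
    LmapUp_d₀ κ (Lmap κ f)
  refine (κ q).hom_ext ?_ ?_ ?_
  · rw [Category.assoc, multUp_d₀, Category.assoc, LmapUp_d₀, ← Category.assoc, ← Category.assoc,
      e, multUp_d₀, Category.assoc, Category.assoc, LmapUp_d₀]
  · refine (Category.assoc _ _ _).trans ((congrArg (_ ≫ ·) (multUp_d₁ κ q)).trans
      ((LmapUp_d₁ κ (Lmap κ f)).trans ?_))
    rw [Category.assoc, LmapUp_d₁, ← Category.assoc, multUp_d₁]
  · refine (wl_multUp_lam κ q _).trans (Eq.trans (vc_congr ?_ (LmapUp_lam κ (Lmap κ f)) _)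
      (wr_multUp_lam κ p f.down).symm |>.trans ?_)
    · rw [e, wl_comp, LmapUp_lam, wr_wl]
    · rw [wl_comp, LmapUp_lam, ← wr_wl]

theorem multUp_naturality₂ {p q : Arr C} {f g : p ⟶ q} (α : f ⟶ g) :
    wr (Arrow.mk (LmapUp₂ κ (Lmap₂ κ α))) (multUp κ q) =
      wl (multUp κ p) (Arrow.mk (LmapUp₂ κ α)) := by
  refine (κ q).arrow_ext (multUp_naturality κ f) (multUp_naturality κ g) ?_ ?_
  · rw [← wr_comp, multUp_d₀, wr_wl, LmapUp₂_d₀, ← wl_comp, multUp_d₀, wr_comp]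
    refine (congrArg (wr · (κ q).d₀) (LmapUp₂_d₀ κ (Lmap₂ κ α))).trans ?_
    rw [wr_wl, LmapUp₂_d₀, wl_comp]
  · rw [← wr_comp, multUp_d₁]
    refine (LmapUp₂_d₁ κ (Lmap₂ κ α)).trans ?_
    rw [wr_wl, LmapUp₂_d₁, ← wl_comp, multUp_d₁]

/-- The multiplication `c : LL ⟶ L`. -/
noncomputable def Lmult : TwoNatTrans ((L κ).comp (L κ)) (L κ) where
  app p := Arr.Hom.mk (multUp κ p) (𝟙 _) ((multUp_d₁ κ p).trans (Category.comp_id _).symm)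
  naturality f := Arr.hom_ext (multUp_naturality κ f) (id_down_naturality f)
  naturality₂ α := Arr.eq_conj _ _ _ _ (multUp_naturality₂ κ α) (id_down_naturality₂ α)

/-- The component at `p` of the unit of the monad `L`. -/
noncomputable abbrev unitHom (p : Arr C) : p ⟶ Lobj κ p :=
  Arr.Hom.mk (unitUp κ p) (𝟙 p.base) ((unitUp_d₁ κ p).trans (Category.comp_id _).symm)

/-- The component at `p` of the multiplication of the monad `L`. -/
noncomputable abbrev multHom (p : Arr C) : Lobj κ (Lobj κ p) ⟶ Lobj κ p :=
  Arr.Hom.mk (multUp κ p) (𝟙 p.base) ((multUp_d₁ κ p).trans (Category.comp_id _).symm)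

theorem L_assoc (p : Arr C) :
    LmapUp κ (multHom κ p) ≫ multUp κ p = multUp κ (Lobj κ p) ≫ multUp κ p := by
  have e₀ : LmapUp κ (multHom κ p) ≫ (κ (Lobj κ p)).d₀ =
    (κ (Lobj κ (Lobj κ p))).d₀ ≫ multUp κ p := LmapUp_d₀ κ (multHom κ p)
  have e₁ : LmapUp κ (multHom κ p) ≫ (κ (Lobj κ p)).d₁ = (κ (Lobj κ (Lobj κ p))).d₁ :=
    (LmapUp_d₁ κ (multHom κ p)).trans (Category.comp_id _)
  have eL : wl (LmapUp κ (multHom κ p)) (Arrow.mk (κ (Lobj κ p)).lam) =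
      Arrow.mk (κ (Lobj κ (Lobj κ p))).lam :=
    (LmapUp_lam κ (multHom κ p)).trans (wr_id _)
  refine (κ p).hom_ext ?_ ?_ ?_
  · rw [Category.assoc, Category.assoc, multUp_d₀, ← Category.assoc, e₀,
      ← Category.assoc, multUp_d₀, Category.assoc, Category.assoc, multUp_d₀]
  · rw [Category.assoc, Category.assoc, multUp_d₁, e₁]
    exact (multUp_d₁ κ (Lobj κ p)).symm
  · have a : wl (LmapUp κ (multHom κ p) ≫ (κ (Lobj κ p)).d₀) (Arrow.mk (κ p).lam) =
        vc (wl ((κ (Lobj κ (Lobj κ p))).d₀ ≫ (κ (Lobj κ p)).d₀) (Arrow.mk (κ p).lam))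
          (wl (κ (Lobj κ (Lobj κ p))).d₀ (Arrow.mk (κ (Lobj κ p)).lam))
          ((Category.assoc _ _ _).trans (congrArg (_ ≫ ·) (mult_boundary κ p))) := by
      rw [e₀]
      exact wl_multUp_lam κ p _
    have b : wl (multUp κ (Lobj κ p) ≫ (κ (Lobj κ p)).d₀) (Arrow.mk (κ p).lam) =
        wl ((κ (Lobj κ (Lobj κ p))).d₀ ≫ (κ (Lobj κ p)).d₀) (Arrow.mk (κ p).lam) :=
      wl_congr (multUp_d₀ κ (Lobj κ p)) rfl
    refine (wl_multUp_lam κ p _).trans ((vc_congr a eL _).trans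
      (Eq.trans (vc_assoc _ _ _ _ ?_) ?_))
    · exact mult_boundary κ (Lobj κ p)
    · exact ((wl_multUp_lam κ p _).trans (vc_congr b (multUp_lam κ (Lobj κ p)) _)).symm

theorem L_left_unit (p : Arr C) : unitUp κ (Lobj κ p) ≫ multUp κ p = 𝟙 _ := by
  have e₀ : unitUp κ (Lobj κ p) ≫ (κ (Lobj κ p)).d₀ = 𝟙 _ := unitUp_d₀ κ (Lobj κ p)
  refine (κ p).hom_ext ?_ ?_ ?_
  · rw [Category.assoc, multUp_d₀, ← Category.assoc, e₀]
  · rw [Category.assoc, multUp_d₁, Category.id_comp]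
    exact unitUp_d₁ κ (Lobj κ p)
  · rw [wl_id]
    refine (wl_multUp_lam κ p _).trans ((vc_congr ((wl_congr e₀ rfl).trans (wl_id _)) (unitUp_lam κ (Lobj κ p)) _).trans ?_)
    exact vc_mk_id _

theorem L_right_unit (p : Arr C) : LmapUp κ (unitHom κ p) ≫ multUp κ p = 𝟙 _ := by
  have e₀ : LmapUp κ (unitHom κ p) ≫ (κ (Lobj κ p)).d₀ = (κ p).d₀ ≫ unitUp κ p :=
    LmapUp_d₀ κ (unitHom κ p)
  have eL : wl (LmapUp κ (unitHom κ p)) (Arrow.mk (κ (Lobj κ p)).lam) = Arrow.mk (κ p).lam :=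
    (LmapUp_lam κ (unitHom κ p)).trans (wr_id _)
  refine (κ p).hom_ext ?_ ?_ ?_
  · rw [Category.assoc, multUp_d₀, ← Category.assoc, e₀, Category.assoc, unitUp_d₀,
      Category.id_comp, Category.comp_id]
  · rw [Category.assoc, multUp_d₁, Category.id_comp]
    exact (LmapUp_d₁ κ (unitHom κ p)).trans (Category.comp_id _)
  · rw [wl_id]
    have a : wl (LmapUp κ (unitHom κ p) ≫ (κ (Lobj κ p)).d₀) (Arrow.mk (κ p).lam) =
        Arrow.mk (𝟙 ((κ p).d₀ ≫ p.proj)) := by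
      rw [e₀, wl_comp, unitUp_lam, wl_mk_id]
    exact (wl_multUp_lam κ p _).trans ((vc_congr a eL _).trans (mk_id_vc _))

/-- The 2-monad `(L, i, c)` on the arrow 2-category. -/
noncomputable def Lmonad : TwoMonad (Arr C) where
  functor := L κ
  unit := Lunit κ
  mult := Lmult κ
  assoc p := Arr.hom_ext (L_assoc κ p) rfl
  left_unit p := Arr.hom_ext (L_left_unit κ p) (Category.id_comp _)
  right_unit p := Arr.hom_ext (L_right_unit κ p) (Category.id_comp _)

/-- The iterates `Lⁿ`, as 2-endofunctors of the arrow 2-category. -/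
noncomputable def Lpow : ℕ → StrictPseudofunctor (Arr C) (Arr C)
  | 0 => StrictPseudofunctor.id (Arr C)
  | n + 1 => (Lpow n).comp (L κ)

/-- The 2-endofunctor `Kₙ` of the arrow 2-category: it sends a bundle `p` over `B` to the upstairs
part `dom Lⁿ p ⟶ dom Lⁿ (𝟙 B)` of `Lⁿ` applied to the square `(p, 𝟙 B) : p ⟶ 𝟙 B`. -/
noncomputable def K (n : ℕ) : StrictPseudofunctor (Arr C) (Arr C) :=
  ((toIdBundle C).whiskerRight ((Lpow κ n).comp (dom C))).toArr

/-- The 2-natural transformation `Kₙ₊₁ ⟶ Kₙ`, given upstairs and downstairs by `d₀`. -/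
noncomputable def d₀K (n : ℕ) : TwoNatTrans (K κ (n + 1)) (K κ n) where
  app p := Arr.Hom.mk (κ ((Lpow κ n).obj p)).d₀ (κ ((Lpow κ n).obj ⟨𝟙 p.base⟩)).d₀
    (LmapUp_d₀ κ ((Lpow κ n).map ((toIdBundle C).app p))).symm
  naturality f := Arr.hom_ext (LmapUp_d₀ κ ((Lpow κ n).map f))
    (LmapUp_d₀ κ ((Lpow κ n).map ((idBundle C).map f.down)))
  naturality₂ α := Arr.eq_conj _ _ _ _ (LmapUp₂_d₀ κ ((Lpow κ n).map₂ α))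
    (LmapUp₂_d₀ κ ((Lpow κ n).map₂ ((idBundle C).map₂ α.down)))

/-- The 2-natural transformation `K₁ ⟶ L`, given upstairs by identities and downstairs by
`d₁ : Φ B ⟶ B`. -/
noncomputable def d₁ : TwoNatTrans (K κ 1) (L κ) where
  app p := Arr.Hom.mk (𝟙 (κ p).pt) (κ ⟨𝟙 p.base⟩).d₁
    ((Category.id_comp _).trans ((Category.comp_id _).symm.trans
      (LmapUp_d₁ κ ((toIdBundle C).app p)).symm))
  naturality f := Arr.hom_ext ((Category.comp_id _).trans (Category.id_comp _).symm)
    (LmapUp_d₁ κ ((idBundle C).map f.down))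
  naturality₂ α := Arr.eq_conj _ _ _ _
    ((wr_id (Arrow.mk (LmapUp₂ κ α))).trans (wl_id (Arrow.mk (LmapUp₂ κ α))).symm)
    (LmapUp₂_d₁ κ ((idBundle C).map₂ α.down))

end Monad

/-! ### Indexed bundle 2-endofunctors and their exchange with `L` -/

section Exchange

variable {C : Type u} [Bicategory.{w, v} C] [Strict C]

/-- A 2-endofunctor of the arrow 2-category is a bundle 2-endofunctor if it commutes strictly with
`cod`. -/
def IsBundleEndo (T : StrictPseudofunctor (Arr C) (Arr C)) : Prop := T.comp (cod C) = cod C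

/-- A 2-endofunctor of the arrow 2-category is indexed if it sends pullback squares to pullback
squares. -/
def IsIndexed (T : StrictPseudofunctor (Arr C) (Arr C)) : Prop :=
  ∀ ⦃p q : Arr C⦄ (f : p ⟶ q), IsTwoPullback f.up p.proj q.proj f.down →
    IsTwoPullback (T.map f).up (T.obj p).proj (T.obj q).proj (T.map f).down

/-- A 2-natural transformation between 2-functors with values in the arrow 2-category is over `cod`
if the downstairs parts of its components are identities. -/
def TwoNatTrans.IsOverCod {D : Type u₁} [Bicategory.{w₁, v₁} D]
    {F G : StrictPseudofunctor D (Arr C)} (α : TwoNatTrans F G) : Prop :=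
  ∀ X : D, ∃ h : (F.obj X).base = (G.obj X).base, Arr.Hom.down (α.app X) = eqToHom h

/-- A 2-natural transformation is a 2-natural isomorphism if it has a two-sided inverse. -/
def TwoNatTrans.IsTwoNatIso {D : Type u₁} [Bicategory.{w₁, v₁} D]
    {E : Type u₂} [Bicategory.{w₂, v₂} E] {F G : StrictPseudofunctor D E}
    (α : TwoNatTrans F G) : Prop :=
  ∃ β : TwoNatTrans G F, ∀ X : D, α.app X ≫ β.app X = 𝟙 (F.obj X) ∧
    β.app X ≫ α.app X = 𝟙 (G.obj X)

variable (κ : CommaChoice C) (T : StrictPseudofunctor (Arr C) (Arr C))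

/-- The recursive characterization of the sequence `ψₙ : T Kₙ ⟶ Kₙ T`. -/
structure IsPsiSeq (ψ : ∀ n : ℕ, TwoNatTrans ((K κ n).comp T) (T.comp (K κ n))) : Prop where
  zero (X : Arr C) : (ψ 0).app X = 𝟙 (T.obj X)
  succ (n : ℕ) (X : Arr C) :
    (ψ (n + 1)).app X ≫ (d₀K κ n).app (T.obj X) = T.map ((d₀K κ n).app X) ≫ (ψ n).app X
  succ_isOverCod (n : ℕ) : (ψ (n + 1)).IsOverCod

/-- The characterization of `Ψ : L T ⟶ T L` in terms of `ψ₁ : T K₁ ⟶ K₁ T` and `d₁ : K₁ ⟶ L`. -/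
structure IsPsiBullet (ψ₁ : TwoNatTrans ((K κ 1).comp T) (T.comp (K κ 1)))
    (Ψ : TwoNatTrans (T.comp (L κ)) ((L κ).comp T)) : Prop where
  isOverCod : Ψ.IsOverCod
  d₁_comp (X : Arr C) : ψ₁.app X ≫ (d₁ κ).app (T.obj X) ≫ Ψ.app X = T.map ((d₁ κ).app X)

end Exchange

section Existence

variable {C : Type u} [Bicategory.{w, v} C] [Strict C]

/-- A comma object of `p : E ⟶ B` and `𝟙 B` as a pullback of `d₀ : Φ B ⟶ B` along `p`. -/
theorem exists_commaObject_of_isTwoPullback {E B P : C} (p : E ⟶ B) (K : CommaObject (𝟙 B) (𝟙 B))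
    {fst : P ⟶ E} {snd : P ⟶ K.pt} (hP : IsTwoPullback fst snd p K.d₀) :
    Nonempty (CommaObject p (𝟙 B)) := by
  have w := hP.isPullback.w
  let lam : fst ≫ p ⟶ (snd ≫ K.d₁) ≫ 𝟙 B :=
    eqToHom (by rw [Category.comp_id, w]) ≫ snd ◁ K.lam ≫
      eqToHom (by rw [Category.comp_id, Category.comp_id])
  have hlam : Arrow.mk lam = wl snd (Arrow.mk K.lam) := by
    rw [Arrow.arrow_mk_eqToHom_comp, Arrow.arrow_mk_comp_eqToHom]
    rfl
  refine ⟨CommaObject.mk (pt := P) fst (snd ≫ K.d₁) lam ?_ ?_⟩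
  · intro S u₀ u₁ σ
    let g : S ⟶ K.pt := K.lift (u₀ ≫ p) u₁ (eqToHom (Category.comp_id _) ≫ σ)
    have g₀ : g ≫ K.d₀ = u₀ ≫ p := K.lift_d₀ _ _ _
    have g₁ : g ≫ K.d₁ = u₁ := K.lift_d₁ _ _ _
    have gl : wl g (Arrow.mk K.lam) = Arrow.mk σ :=
      (K.lift_lam _ _ _).trans (Arrow.arrow_mk_eqToHom_comp _ _)
    refine ⟨hP.isPullback.lift u₀ g g₀.symm, ⟨?_, ?_, ?_⟩, ?_⟩
    · exact hP.isPullback.lift_fst _ _ _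
    · rw [← Category.assoc, hP.isPullback.lift_snd, g₁]
    · refine (eq_conj_iff _ _ _ _).2 ?_
      rw [mk_wl, hlam, ← wl_comp, hP.isPullback.lift_snd, gl]
    · rintro f ⟨h₀, h₁, h⟩
      have h' := (eq_conj_iff _ _ _ _).1 h
      rw [mk_wl, hlam, ← wl_comp] at h'
      refine hP.isPullback.hom_ext ?_ ?_
      · rw [h₀, hP.isPullback.lift_fst]
      · rw [hP.isPullback.lift_snd]
        refine K.hom_ext ?_ ?_ ?_
        · rw [g₀, Category.assoc, ← w, ← Category.assoc, h₀]
        · rw [g₁, Category.assoc, h₁]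
        · rw [gl, h']
  · intro S f f' ξ η h
    have hc := (comma_compat_iff lam ξ η).1 h
    have c₀ : ∀ k : S ⟶ P, (k ≫ snd) ≫ K.d₀ = (k ≫ fst) ≫ p := fun k => by
      rw [Category.assoc, ← w, Category.assoc]
    let ξ' : (f ≫ snd) ≫ K.d₀ ⟶ (f' ≫ snd) ≫ K.d₀ :=
      eqToHom (c₀ f) ≫ ξ ▷ p ≫ eqToHom (c₀ f').symm
    let η' : (f ≫ snd) ≫ K.d₁ ⟶ (f' ≫ snd) ≫ K.d₁ :=
      eqToHom (Category.assoc _ _ _) ≫ η ≫ eqToHom (Category.assoc _ _ _).symm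
    have eξ : Arrow.mk ξ' = wr (Arrow.mk ξ) p :=
      (Arrow.arrow_mk_eqToHom_comp _ _).trans (Arrow.arrow_mk_comp_eqToHom _ _)
    have eη : Arrow.mk η' = Arrow.mk η :=
      (Arrow.arrow_mk_eqToHom_comp _ _).trans (Arrow.arrow_mk_comp_eqToHom _ _)
    have el : ∀ k : S ⟶ P, wl (k ≫ snd) (Arrow.mk K.lam) = wl k (Arrow.mk lam) := fun k => by
      rw [hlam, wl_comp]
    have hK : vc (wr (Arrow.mk ξ') (𝟙 B)) (wl (f' ≫ snd) (Arrow.mk K.lam))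
          (Category.assoc _ _ _) =
        vc (wl (f ≫ snd) (Arrow.mk K.lam)) (wr (Arrow.mk η') (𝟙 B))
          (Category.assoc _ _ _).symm :=
      (vc_congr ((wr_id _).trans eξ) (el f') _).trans
        (hc.trans (vc_congr (el f).symm (congrArg (wr · (𝟙 B)) eη.symm) _))
    let θ : f ≫ snd ⟶ f' ≫ snd := K.lift₂ _ _ ξ' η' hK
    have θ₀ : θ ▷ K.d₀ = ξ' := K.lift₂_d₀ _ _ _ _ hK
    have θ₁ : θ ▷ K.d₁ = η' := K.lift₂_d₁ _ _ _ _ hK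
    have e₁ : ∀ φ : f ⟶ f', Arrow.mk ((φ ▷ snd) ▷ K.d₁) = Arrow.mk (φ ▷ (snd ≫ K.d₁)) :=
      fun φ => (wr_comp (Arrow.mk φ) snd K.d₁).symm
    have e₀ : ∀ φ : f ⟶ f', Arrow.mk ((φ ▷ snd) ▷ K.d₀) = Arrow.mk ((φ ▷ fst) ▷ p) :=
      fun φ => (wr_comp (Arrow.mk φ) snd K.d₀).symm.trans
        ((congrArg (wr (Arrow.mk φ)) w.symm).trans (wr_comp (Arrow.mk φ) fst p))
    obtain ⟨φ, ⟨h₀, h₁⟩, hu⟩ := hP.existsUnique_lift₂ f f' ξ θ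
      ((eq_conj_iff _ _ _ _).2 ((congrArg Arrow.mk θ₀).trans eξ).symm)
    refine ⟨φ, ⟨h₀, ?_⟩, ?_⟩
    · refine Arrow.mk_injective _ _ ((e₁ φ).symm.trans ?_)
      rw [h₁, θ₁, eη]
    · rintro φ' ⟨h₀', h₁'⟩
      refine hu φ' ⟨h₀', K.hom₂_ext ?_ ?_⟩
      · refine (e₀ φ').trans (Eq.trans ?_ ((congrArg Arrow.mk θ₀).trans eξ).symm)
        rw [h₀']
        rfl
      · refine (e₁ φ').trans (Eq.trans ?_ ((congrArg Arrow.mk θ₁).trans eη).symm)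
        rw [h₁']

/-- In a representable 2-category all the comma objects `p/B` exist. -/
theorem Representable.nonempty_commaChoice [Representable C] : Nonempty (CommaChoice C) := by
  refine Classical.nonempty_pi.2 fun p => ?_
  obtain ⟨K⟩ := Representable.exists_comma p.base
  obtain ⟨P, fst, snd, hP⟩ := Representable.exists_pullback p.proj K.d₀
  exact exists_commaObject_of_isTwoPullback p.proj K hP

end Existence

end ArrowTwoCat

open ArrowTwoCat

/-! Everything rests on one fact: each component of `d₀` from `Kₙ₊₁` to `Kₙ` is a 2-pullback square.
For n = 0 it says that p/B is the pullback of d₀ : Φ B → B along p. In general Lⁿ(p, 1_B) is a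
square with an invertible downstairs part, and over such a square the comma object of the source is
the pullback of that of the target (`isTwoPullback_LmapUp`, `isCartesian_d₀K`).

A 1-cell or 2-cell of the arrow 2-category into the source of a cartesian square is determined by
its downstairs part and its composite with the square. Hence 2-natural transformations lift through
componentwise cartesian ones, and the lift is unique once its downstairs part is fixed
(`TwoNatTrans.exists_lift`). So ψₙ₊₁ is forced: it is the lift of (T d₀) followed by ψₙ through d₀ T
with identity downstairs. Since T preserves 2-pullbacks, T d₀ is cartesian as well; the inverse of
ψₙ then lifts to an inverse of ψₙ₊₁.

Since d₁ : K₁ → L is the identity upstairs, the condition on Ψ prescribes its upstairs part: it is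
that of the inverse of ψ₁ followed by T d₁. This gives existence and uniqueness.

For the monad laws, i and c are lifted along d₁ to maps Id → K₁ and K₂ → K₁, and a shift K₂ → K₁L
accounts for the inner L. The ψₙ commute with all of these, because both sides of each equation
agree downstairs and after the cartesian d₀ (`map_unitK_psiHom`, `map_multK_psiHom`,
`psiHom_shiftPsi`). Composing with d₁, cancelling the invertible ψ₂ in the case of c, and reading
the result upstairs yields the two transition laws. -/

namespace ArrowTwoCat

/-! ### Extensionality for strict 2-functors and 2-natural transformations. -/

section StrictExt

variable {B : Type u₁} [Bicategory.{w₁, v₁} B] {C : Type u₂} [Bicategory.{w₂, v₂} C]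

/-- The coherence isomorphisms carry no information: strictness makes each of them the one induced
by an equality of 1-cells. -/
theorem strictPseudofunctor_ext {F G : StrictPseudofunctor B C}
    (h : F.toPrelaxFunctor = G.toPrelaxFunctor) : F = G := by
  obtain ⟨⟨⟨P, i, c, _, _, _, _, _⟩, hi, ei⟩, hc, ec⟩ := F
  obtain ⟨⟨⟨P', i', c', _, _, _, _, _⟩, hi', ei'⟩, hc', ec'⟩ := G
  obtain rfl : P = P' := h
  obtain rfl : i = i' := funext fun a => (ei a).trans (ei' a).symm
  obtain rfl : @c = @c' := by
    funext a b d f g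
    exact (ec f g).trans (ec' f g).symm
  rfl

theorem TwoNatTrans.ext' {F G : StrictPseudofunctor B C} {α β : TwoNatTrans F G}
    (h : ∀ X, α.app X = β.app X) : α = β := by
  obtain ⟨a, _, _⟩ := α
  obtain ⟨b, _, _⟩ := β
  obtain rfl : a = b := funext h
  rfl

end StrictExt

/-! ### Bundle 2-endofunctors with definitionally trivial action on bases. -/

variable {C : Type u} [Bicategory.{w, v} C] [Strict C]

/-- A bundle 2-endofunctor whose effect downstairs is definitionally the identity. -/
structure StrictBundleEndo (C : Type u) [Bicategory.{w, v} C] [Strict C] where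
  /-- The total object of the value at a bundle. -/
  total : Arr C → C
  /-- The projection of the value at a bundle. -/
  proj (p : Arr C) : total p ⟶ p.base
  /-- The upstairs part of the value at a 1-cell. -/
  up {p q : Arr C} (f : p ⟶ q) : total p ⟶ total q
  w {p q : Arr C} (f : p ⟶ q) : up f ≫ proj q = proj p ≫ f.down
  /-- The upstairs part of the value at a 2-cell. -/
  up₂ {p q : Arr C} {f g : p ⟶ q} (α : f ⟶ g) : up f ⟶ up g
  w₂ {p q : Arr C} {f g : p ⟶ q} (α : f ⟶ g) :
    up₂ α ▷ proj q = eqToHom (w f) ≫ proj p ◁ α.down ≫ eqToHom (w g).symm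
  up_id (p : Arr C) : up (𝟙 p) = 𝟙 (total p)
  up_comp {p q r : Arr C} (f : p ⟶ q) (g : q ⟶ r) : up (f ≫ g) = up f ≫ up g
  up₂_id {p q : Arr C} (f : p ⟶ q) : up₂ (𝟙 f) = 𝟙 (up f)
  up₂_comp {p q : Arr C} {f g h : p ⟶ q} (α : f ⟶ g) (β : g ⟶ h) :
    up₂ (α ≫ β) = up₂ α ≫ up₂ β
  up₂_whiskerLeft {p q r : Arr C} (f : p ⟶ q) {g h : q ⟶ r} (η : g ⟶ h) :
    up₂ (f ◁ η) = eqToHom (up_comp f g) ≫ up f ◁ up₂ η ≫ eqToHom (up_comp f h).symm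
  up₂_whiskerRight {p q r : Arr C} {f g : p ⟶ q} (η : f ⟶ g) (h : q ⟶ r) :
    up₂ (η ▷ h) = eqToHom (up_comp f h) ≫ up₂ η ▷ up h ≫ eqToHom (up_comp g h).symm

namespace StrictBundleEndo

/-- The 2-endofunctor of the arrow 2-category underlying a strict bundle 2-endofunctor. -/
def functor (S : StrictBundleEndo C) : StrictPseudofunctor (Arr C) (Arr C) :=
  StrictPseudofunctor.mk''
  { obj := fun p => ⟨S.proj p⟩
    map := fun f => Arr.Hom.mk (S.up f) f.down (S.w f)
    map₂ := fun α => Arr.Hom₂.mk (S.up₂ α) α.down (S.w₂ α)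
    map₂_id := fun f => Arr.hom₂_ext (S.up₂_id f) rfl
    map₂_comp := fun α β => Arr.hom₂_ext (S.up₂_comp α β) rfl
    map_id := fun p => Arr.hom_ext (S.up_id p) rfl
    map_comp := fun f g => Arr.hom_ext (S.up_comp f g) rfl
    map₂_whisker_left := fun f _ _ η => Arr.hom₂_ext
      ((S.up₂_whiskerLeft f η).trans (by simp)) (by simp)
    map₂_whisker_right := fun η h => Arr.hom₂_ext
      ((S.up₂_whiskerRight η h).trans (by simp)) (by simp) }

end StrictBundleEndo

/-- The upstairs part of an unbundled 2-cell of the arrow 2-category. -/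
def Arr.upArrow {p q : Arr C} (x : Arrow (p ⟶ q)) : Arrow (p.total ⟶ q.total) :=
  Arrow.mk x.hom.up

/-- The downstairs part of an unbundled 2-cell of the arrow 2-category. -/
def Arr.downArrow {p q : Arr C} (x : Arrow (p ⟶ q)) : Arrow (p.base ⟶ q.base) :=
  Arrow.mk x.hom.down

theorem Arr.eq_mk_eqToHom {p : Arr C} {b : C} (h : p.base = b) :
    p = ⟨p.proj ≫ eqToHom h⟩ := by
  subst h
  simp

/-- Replaces the propositional equality of 2-functors `T.comp (cod C) = cod C` by definitional
equalities of bases and downstairs parts. Afterwards composites such as `S.functor` followed by `K κ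
n` have downstairs parts that match on the nose, and "over `cod`" can be stated with plain
identities. -/
theorem IsBundleEndo.exists_strict {T : StrictPseudofunctor (Arr C) (Arr C)}
    (hT : IsBundleEndo T) : ∃ S : StrictBundleEndo C, T = S.functor := by
  have h₀ : ∀ p, (T.obj p).base = p.base := fun p =>
    congrArg (fun F : StrictPseudofunctor (Arr C) C => F.obj p) hT
  -- Heterogeneous equality is needed because at this stage the bases of `T.obj p` and `p` agree
  -- only propositionally.
  have h₁ : ∀ {p q : Arr C} (f : p ⟶ q), HEq (T.map f).down f.down := fun {p q} f => by
    change HEq ((T.comp (cod C)).map f) ((cod C).map f)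
    rw [show T.comp (cod C) = cod C from hT]
  have h₂ : ∀ {p q : Arr C} {f g : p ⟶ q} (α : f ⟶ g), HEq (T.map₂ α).down α.down :=
    fun {p q f g} α => by
      change HEq ((T.comp (cod C)).map₂ α) ((cod C).map₂ α)
      rw [show T.comp (cod C) = cod C from hT]
  -- The whiskering laws are recorded for unbundled 2-cells, where no coherence cells of `T` appear,
  -- so that they survive taking `T` apart.
  have hl : ∀ {p q r : Arr C} (f : p ⟶ q) {g h : q ⟶ r} (η : g ⟶ h),
      Arrow.mk (T.map₂ (f ◁ η)) = wl (T.map f) (Arrow.mk (T.map₂ η)) := mk_map₂_whiskerLeft T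
  have hr : ∀ {p q r : Arr C} {f g : p ⟶ q} (η : f ⟶ g) (h : q ⟶ r),
      Arrow.mk (T.map₂ (η ▷ h)) = wr (Arrow.mk (T.map₂ η)) (T.map h) := mk_map₂_whiskerRight T
  clear hT
  obtain ⟨⟨⟨⟨⟨⟨obj, map⟩, map₂⟩, m₂id, m₂comp⟩, _, _, _, _, _, _, _⟩, hi, _⟩, hc, _⟩ := T
  dsimp only at *
  -- Objects, 1-cells and 2-cells are normalized in turn. Each substitution makes the boundaries at
  -- the next level definitionally equal, which turns the next heterogeneous equality into an
  -- ordinary one.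
  obtain ⟨total, proj, rfl⟩ : ∃ (total : Arr C → C) (proj : ∀ p : Arr C, total p ⟶ p.base),
      obj = fun p => ⟨proj p⟩ := by
    refine ⟨fun p => (obj p).total, fun p => (obj p).proj ≫ eqToHom (h₀ p), ?_⟩
    funext p
    exact Arr.eq_mk_eqToHom (h₀ p)
  obtain ⟨up, w, rfl⟩ : ∃ (up : ∀ {p q : Arr C} (f : p ⟶ q), total p ⟶ total q)
      (w : ∀ {p q : Arr C} (f : p ⟶ q), up f ≫ proj q = proj p ≫ f.down),
      @map = @fun (p q : Arr C) (f : p ⟶ q) =>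
        Arr.Hom.mk (p := ⟨proj p⟩) (q := ⟨proj q⟩) (up f) f.down (w f) := by
    refine ⟨fun f => (map f).up, fun f => (map f).w.trans ?_, ?_⟩
    · rw [eq_of_heq (h₁ f)]
    · funext p q f
      exact Arr.hom_ext rfl (eq_of_heq (h₁ f))
  obtain ⟨up₂, w₂, rfl⟩ : ∃ (up₂ : ∀ {p q : Arr C} {f g : p ⟶ q} (α : f ⟶ g), up f ⟶ up g)
      (w₂ : ∀ {p q : Arr C} {f g : p ⟶ q} (α : f ⟶ g), up₂ α ▷ proj q =
        eqToHom (w f) ≫ proj p ◁ α.down ≫ eqToHom (w g).symm),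
      @map₂ = @fun (p q : Arr C) (f g : p ⟶ q) (α : f ⟶ g) =>
        Arr.Hom₂.mk (f := Arr.Hom.mk (p := ⟨proj p⟩) (q := ⟨proj q⟩) (up f) f.down (w f))
          (g := Arr.Hom.mk (p := ⟨proj p⟩) (q := ⟨proj q⟩) (up g) g.down (w g))
          (up₂ α) α.down (w₂ α) := by
    refine ⟨fun α => (map₂ α).up, fun α => (map₂ α).w.trans ?_, ?_⟩
    · rw [eq_of_heq (h₂ α)]
    · funext p q f g α
      exact Arr.hom₂_ext rfl (eq_of_heq (h₂ α))
  refine ⟨⟨total, proj, up, w, up₂, w₂, fun p => congrArg Arr.Hom.up (hi p),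
    fun f g => congrArg Arr.Hom.up (hc f g), fun f => congrArg Arr.Hom₂.up (m₂id f),
    fun α β => congrArg Arr.Hom₂.up (m₂comp α β),
    fun f _ _ η => (eq_conj_iff _ _ _ _).2 (congrArg Arr.upArrow (hl f η)),
    fun η h => (eq_conj_iff _ _ _ _).2 (congrArg Arr.upArrow (hr η h))⟩,
    strictPseudofunctor_ext rfl⟩

/-! ### Cartesian 1-cells of the arrow 2-category and lifting through them. -/

section Cartesian

variable {C : Type u} [Bicategory.{w, v} C] [Strict C]

theorem IsTwoPullback.arrow_ext {P X Y Z : C} {fst : P ⟶ X} {snd : P ⟶ Y} {f : X ⟶ Z}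
    {g : Y ⟶ Z} (h : IsTwoPullback fst snd f g) {S : C} {x y : Arrow (S ⟶ P)}
    (hl : x.left = y.left) (hr : x.right = y.right)
    (h₁ : wr x fst = wr y fst) (h₂ : wr x snd = wr y snd) : x = y := by
  obtain ⟨k, k', φ⟩ := x
  obtain ⟨l, l', φ'⟩ := y
  change k = l at hl
  change k' = l' at hr
  subst hl hr
  refine congrArg Arrow.mk ((h.existsUnique_lift₂ k k' (φ' ▷ fst) (φ' ▷ snd) ?_).unique
    ⟨Arrow.mk_injective _ _ h₁, Arrow.mk_injective _ _ h₂⟩ ⟨rfl, rfl⟩)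
  refine (eq_conj_iff _ _ _ _).2 ?_
  change wr (wr (Arrow.mk φ') fst) f = wr (wr (Arrow.mk φ') snd) g
  rw [← wr_comp, ← wr_comp, h.isPullback.w]

/-- A 1-cell of the arrow 2-category is cartesian if it is a 2-pullback square. -/
def Arr.IsCartesian {p q : Arr C} (f : p ⟶ q) : Prop :=
  IsTwoPullback f.up p.proj q.proj f.down

/-- Commutativity of the squares `g` and `h` derives the second pullback leg from their common
downstairs part. -/
theorem Arr.IsCartesian.hom_ext {p q r : Arr C} {f : q ⟶ r} (hf : Arr.IsCartesian f)
    {g h : p ⟶ q} (hd : g.down = h.down) (e : g ≫ f = h ≫ f) : g = h := by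
  refine Arr.hom_ext (hf.isPullback.hom_ext (congrArg Arr.Hom.up e) ?_) hd
  rw [g.w, h.w, hd]

theorem Arr.IsCartesian.exists_lift {p q r : Arr C} {f : q ⟶ r} (hf : Arr.IsCartesian f)
    (g : p ⟶ r) (δ : p.base ⟶ q.base) (h : δ ≫ f.down = g.down) :
    ∃ k : p ⟶ q, k.down = δ ∧ k ≫ f = g := by
  have e : g.up ≫ r.proj = (p.proj ≫ δ) ≫ f.down := by rw [g.w, Category.assoc, h]
  exact ⟨⟨hf.isPullback.lift _ _ e, δ, hf.isPullback.lift_snd _ _ e⟩, rfl,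
    Arr.hom_ext (hf.isPullback.lift_fst _ _ e) h⟩

theorem Arr.arrow_ext {p q : Arr C} {x y : Arrow (p ⟶ q)} (hl : x.left = y.left)
    (hr : x.right = y.right) (hu : Arr.upArrow x = Arr.upArrow y)
    (hd : Arr.downArrow x = Arr.downArrow y) : x = y := by
  obtain ⟨f, g, φ⟩ := x
  obtain ⟨f', g', φ'⟩ := y
  change f = f' at hl
  change g = g' at hr
  subst hl hr
  exact congrArg Arrow.mk (Arr.hom₂_ext (Arrow.mk_injective _ _ hu) (Arrow.mk_injective _ _ hd))

/-- The 2-dimensional counterpart of `Arr.IsCartesian.hom_ext`: compatibility of a 2-cell's two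
parts supplies the second pullback leg. -/
theorem Arr.IsCartesian.arrow_ext {p q r : Arr C} {f : q ⟶ r} (hf : Arr.IsCartesian f)
    {x y : Arrow (p ⟶ q)} (hl : x.left = y.left) (hr : x.right = y.right)
    (hd : Arr.downArrow x = Arr.downArrow y) (e : wr x f = wr y f) : x = y := by
  refine Arr.arrow_ext hl hr (IsTwoPullback.arrow_ext hf (congrArg Arr.Hom.up hl)
    (congrArg Arr.Hom.up hr) (congrArg Arr.upArrow e) ?_) hd
  exact (Arr.Hom₂.cell x.hom).trans ((congrArg (wl p.proj) hd).trans (Arr.Hom₂.cell y.hom).symm)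

variable {D : Type u₁} [Bicategory.{w₁, v₁} D]

/-- 2-natural transformations lift uniquely through 2-natural transformations with cartesian
components. -/
theorem TwoNatTrans.exists_lift {F F' G G' : StrictPseudofunctor D (Arr C)} (α : TwoNatTrans F F')
    (β : TwoNatTrans G G') (ψ : TwoNatTrans F' G') (hβ : ∀ X, Arr.IsCartesian (β.app X))
    (δ : TwoNatTrans (F.comp (cod C)) (G.comp (cod C)))
    (h : ∀ X, δ.app X ≫ (β.app X).down = (α.app X ≫ ψ.app X).down) :
    ∃ χ : TwoNatTrans F G, ∀ X, (χ.app X).down = δ.app X ∧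
      χ.app X ≫ β.app X = α.app X ≫ ψ.app X := by
  choose k hk hk' using fun X => (hβ X).exists_lift (α.app X ≫ ψ.app X) (δ.app X) (h X)
  -- Naturality of the pointwise lifts is itself an instance of uniqueness: downstairs it is
  -- naturality of `δ`, and after `β` it is that of `α`, `β` and `ψ`. The 2-cell condition below is
  -- treated in the same way.
  have nat : ∀ {X Y : D} (f : X ⟶ Y), F.map f ≫ k Y = k X ≫ G.map f := fun {X Y} f => by
    refine (hβ Y).hom_ext ?_ ?_
    · rw [Arr.comp_down, Arr.comp_down, hk, hk]
      exact δ.naturality f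
    · rw [Category.assoc, hk', Category.assoc, β.naturality, ← Category.assoc, ← Category.assoc,
        hk', α.naturality, Category.assoc, Category.assoc, ψ.naturality]
  refine ⟨⟨k, nat, fun {X Y f g} η => (eq_conj_iff _ _ _ _).2 ?_⟩, fun X => ⟨hk X, hk' X⟩⟩
  refine (hβ Y).arrow_ext (nat f) (nat g) ?_ ?_
  · change wr (Arrow.mk (F.map₂ η).down) (k Y).down = wl (k X).down (Arrow.mk (G.map₂ η).down)
    rw [hk, hk]
    exact δ.cell η
  · change wr (wr (Arrow.mk (F.map₂ η)) (k Y)) _ = wr (wl (k X) (Arrow.mk (G.map₂ η))) _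
    rw [← wr_comp, hk', wr_comp, α.cell, wr_wl, ψ.cell, wr_wl, β.cell, ← wl_comp, ← wl_comp, hk']

end Cartesian

/-! ### The transformations `d₀` are componentwise 2-pullbacks. -/

section Pasting

variable {C : Type u} [Bicategory.{w, v} C] [Strict C]

/-- The interchange law for a 2-cell into a comma object and the universal 2-cell. -/
theorem CommaObject.interchange {A B D : C} {r : A ⟶ D} {s : B ⟶ D} (K : CommaObject r s) {S : C}
    {f f' : S ⟶ K.pt} (φ : f ⟶ f') :
    vc (wr (wr (Arrow.mk φ) K.d₀) r) (wl f' (Arrow.mk K.lam)) (Category.assoc f' K.d₀ r) =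
      vc (wl f (Arrow.mk K.lam)) (wr (wr (Arrow.mk φ) K.d₁) s)
        (Category.assoc f K.d₁ s).symm := by
  refine (K.compat_iff (φ ▷ K.d₀) (φ ▷ K.d₁)).1 ?_
  rw [associator_naturality_left_assoc, ← whisker_exchange]
  simp

variable (κ : CommaChoice C)

/-- The comma object of a composite is a pullback of a comma object. -/
theorem isTwoPullback_LmapUp {p q : Arr C} (f : p ⟶ q) (g : q.base ⟶ p.base)
    (h : f.down ≫ g = 𝟙 p.base) (h' : g ≫ f.down = 𝟙 q.base) :
    IsTwoPullback (κ p).d₀ (LmapUp κ f) f.up (κ q).d₀ := by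
  -- Because `g` inverts `f.down`, the data of the comma object of `p` (the bundle, the universal
  -- 2-cell and `d₁`) are recovered from those of `q` by whiskering with `g`.
  have hp : f.up ≫ q.proj ≫ g = p.proj := by
    rw [← Category.assoc, f.w, Category.assoc, h, Category.comp_id]
  have lam_eq : ∀ {S : C} (m : S ⟶ (κ p).pt),
      wr (wl (m ≫ LmapUp κ f) (Arrow.mk (κ q).lam)) g = wl m (Arrow.mk (κ p).lam) := fun m => by
    rw [wl_comp, LmapUp_lam, ← wr_wl, ← wr_comp, h, wr_id]
  have d₁_eq : ∀ {S : C} (m : S ⟶ (κ p).pt), ((m ≫ LmapUp κ f) ≫ (κ q).d₁) ≫ g = m ≫ (κ p).d₁ :=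
    fun m => by
      rw [Category.assoc m, LmapUp_d₁, Category.assoc, Category.assoc, h, Category.comp_id]
  have lift : ∀ {S : C} (a : S ⟶ p.total) (b : S ⟶ (κ q).pt), a ≫ f.up = b ≫ (κ q).d₀ →
      ∃ m : S ⟶ (κ p).pt, m ≫ (κ p).d₀ = a ∧ m ≫ LmapUp κ f = b := fun {S} a b e => by
    have e₀ : a ≫ p.proj = (b ≫ (κ q).d₀ ≫ q.proj) ≫ g := by
      rw [← Category.assoc b, ← e, Category.assoc, Category.assoc, hp]
    -- The 2-cell classified by `b`, carried back along `g`; it induces the required 1-cell into the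
    -- comma object of `p`.
    let σ : a ≫ p.proj ⟶ ((b ≫ (κ q).d₁) ≫ g) ≫ 𝟙 p.base :=
      eqToHom e₀ ≫ (b ◁ (κ q).lam) ▷ g ≫ eqToHom (by simp)
    have hσ : Arrow.mk σ = wr (wl b (Arrow.mk (κ q).lam)) g := by
      rw [Arrow.arrow_mk_eqToHom_comp, Arrow.arrow_mk_comp_eqToHom]
      rfl
    refine ⟨(κ p).lift a ((b ≫ (κ q).d₁) ≫ g) σ, (κ p).lift_d₀ _ _ _,
      (κ q).hom_ext ?_ ?_ ?_⟩
    · rw [Category.assoc, LmapUp_d₀, ← Category.assoc, (κ p).lift_d₀, e]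
    · rw [Category.assoc, LmapUp_d₁, ← Category.assoc, (κ p).lift_d₁, Category.assoc, h',
        Category.comp_id]
    · rw [wl_comp, LmapUp_lam, ← wr_wl, (κ p).lift_lam, hσ, ← wr_comp, h', wr_id]
  have ext : ∀ {S : C} (m m' : S ⟶ (κ p).pt), m ≫ (κ p).d₀ = m' ≫ (κ p).d₀ →
      m ≫ LmapUp κ f = m' ≫ LmapUp κ f → m = m' := fun m m' e₀ e₁ =>
    (κ p).hom_ext e₀ (by rw [← d₁_eq m, e₁, d₁_eq]) (by rw [← lam_eq m, e₁, lam_eq])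
  refine ⟨⟨⟨(LmapUp_d₀ κ f).symm⟩, ⟨Limits.PullbackCone.IsLimit.mk _
    (fun s => (lift s.fst s.snd s.condition).choose)
    (fun s => (lift s.fst s.snd s.condition).choose_spec.1)
    (fun s => (lift s.fst s.snd s.condition).choose_spec.2)
    (fun s m h₀ h₁ => ext _ _ (h₀.trans (lift s.fst s.snd s.condition).choose_spec.1.symm)
      (h₁.trans (lift s.fst s.snd s.condition).choose_spec.2.symm))⟩⟩, ?_⟩
  intro S k k' ξ η e
  have e := (eq_conj_iff _ _ _ _).1 e
  change wr (Arrow.mk ξ) f.up = wr (Arrow.mk η) (κ q).d₀ at e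
  -- The component over `d₁` is not part of the pullback data; it is forced by `η`, again by
  -- whiskering with `g`.
  let η' : k ≫ (κ p).d₁ ⟶ k' ≫ (κ p).d₁ :=
    eqToHom (d₁_eq k).symm ≫ (η ▷ (κ q).d₁) ▷ g ≫ eqToHom (d₁_eq k')
  have hη' : Arrow.mk η' = wr (wr (Arrow.mk η) (κ q).d₁) g := by
    rw [Arrow.arrow_mk_eqToHom_comp, Arrow.arrow_mk_comp_eqToHom]
    rfl
  have hc : vc (wr (Arrow.mk ξ) p.proj) (wl k' (Arrow.mk (κ p).lam)) (Category.assoc _ _ _) =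
      vc (wl k (Arrow.mk (κ p).lam)) (wr (Arrow.mk η') (𝟙 p.base))
        (Category.assoc _ _ _).symm := by
    -- The compatibility required over `p` is the interchange law for `η` over `q`, whiskered with
    -- `g`.
    have hi := (wr_vc _ _ _ _).symm.trans
      ((congrArg (wr · g) ((κ q).interchange η)).trans (wr_vc _ _ _ _))
    refine (vc_congr ?_ (lam_eq k').symm _).trans (hi.trans (vc_congr (lam_eq k) ?_ _))
    · rw [← e, ← wr_comp, ← wr_comp, hp]
    · rw [hη', wr_id, wr_id]
  refine ⟨(κ p).lift₂ k k' ξ η' hc, ⟨(κ p).lift₂_d₀ _ _ _ _ hc, ?_⟩, ?_⟩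
  · refine (κ q).hom₂_ext ?_ ?_
    · change wr (wr (Arrow.mk ((κ p).lift₂ k k' ξ η' hc)) (LmapUp κ f)) _ = _
      rw [← wr_comp, LmapUp_d₀, wr_comp, ← e]
      exact congrArg (fun x => wr (Arrow.mk x) f.up) ((κ p).lift₂_d₀ _ _ _ _ hc)
    · change wr (wr (Arrow.mk ((κ p).lift₂ k k' ξ η' hc)) (LmapUp κ f)) _ = _
      rw [← wr_comp, LmapUp_d₁, wr_comp]
      refine (congrArg (fun x => wr (Arrow.mk x) f.down) ((κ p).lift₂_d₁ _ _ _ _ hc)).trans ?_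
      rw [hη', ← wr_comp, h', wr_id]
  · rintro φ ⟨h₀, h₁⟩
    refine (κ p).hom₂_ext ?_ ?_
    · exact congrArg Arrow.mk (h₀.trans ((κ p).lift₂_d₀ _ _ _ _ hc).symm)
    · refine Eq.trans ?_ (congrArg Arrow.mk ((κ p).lift₂_d₁ _ _ _ _ hc)).symm
      rw [hη', ← h₁, mk_wr, ← wr_comp _ (LmapUp κ f), LmapUp_d₁, ← wr_comp, Category.assoc, h,
        Category.comp_id]

/-- `L` does not change downstairs parts, so each induction step is a definitional equality. -/
theorem exists_inverse_Lpow_map_down (n : ℕ) {p q : Arr C} (f : p ⟶ q)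
    (hf : ∃ g : q.base ⟶ p.base, f.down ≫ g = 𝟙 p.base ∧ g ≫ f.down = 𝟙 q.base) :
    ∃ g, ((Lpow κ n).map f).down ≫ g = 𝟙 _ ∧ g ≫ ((Lpow κ n).map f).down = 𝟙 _ := by
  induction n with
  | zero => exact hf
  | succ n ih => exact ih

/-- The square (p, 1_B) is invertible downstairs, hence so is its image under Lⁿ, and
`isTwoPullback_LmapUp` applies. -/
theorem isCartesian_d₀K (n : ℕ) (p : Arr C) : Arr.IsCartesian ((d₀K κ n).app p) := by
  obtain ⟨g, h, h'⟩ := exists_inverse_Lpow_map_down κ n ((toIdBundle C).app p)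
    ⟨𝟙 p.base, Category.id_comp _, Category.id_comp _⟩
  exact isTwoPullback_LmapUp κ _ g h h'

end Pasting

/-! ### Lifting invertibility; composition and whiskering of 2-natural transformations. -/

section Iso

variable {C : Type u} [Bicategory.{w, v} C] [Strict C] {D : Type u₁} [Bicategory.{w₁, v₁} D]
  {E : Type u₂} [Bicategory.{w₂, v₂} E] {F F' G G' : StrictPseudofunctor D (Arr C)}

/-- A lift of a 2-natural isomorphism through cartesian 2-natural transformations is a 2-natural
isomorphism as soon as it is one downstairs. -/
theorem TwoNatTrans.isTwoNatIso_of_isCartesian (α : TwoNatTrans F F') (β : TwoNatTrans G G')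
    {ψ : TwoNatTrans F' G'} (χ : TwoNatTrans F G) (hα : ∀ X, Arr.IsCartesian (α.app X))
    (hβ : ∀ X, Arr.IsCartesian (β.app X)) (hψ : ψ.IsTwoNatIso)
    (δ : TwoNatTrans (G.comp (cod C)) (F.comp (cod C)))
    (h₁ : ∀ X, (χ.app X).down ≫ δ.app X = 𝟙 (F.obj X).base)
    (h₂ : ∀ X, δ.app X ≫ (χ.app X).down = 𝟙 (G.obj X).base)
    (h : ∀ X, χ.app X ≫ β.app X = α.app X ≫ ψ.app X) : χ.IsTwoNatIso := by
  obtain ⟨θ, hθ⟩ := hψ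
  have hβθ : ∀ X, χ.app X ≫ β.app X ≫ θ.app X = α.app X := fun X => by
    rw [← Category.assoc, h, Category.assoc, (hθ X).1, Category.comp_id]
  -- The inverse is the lift of `β` followed by `θ` through the cartesian `α`; both composites with
  -- `χ` are identities by uniqueness of lifts.
  obtain ⟨χ', hχ'⟩ := TwoNatTrans.exists_lift β α θ hα δ fun X => by
    rw [← hβθ]
    exact (Category.assoc _ _ _).symm.trans
      ((congrArg (· ≫ (β.app X ≫ θ.app X).down) (h₂ X)).trans (Category.id_comp _))
  refine ⟨χ', fun X => ⟨(hα X).hom_ext ?_ ?_, (hβ X).hom_ext ?_ ?_⟩⟩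
  · rw [Arr.comp_down, (hχ' X).1]
    exact h₁ X
  · rw [Category.assoc, (hχ' X).2, hβθ, Category.id_comp]
  · rw [Arr.comp_down, (hχ' X).1]
    exact h₂ X
  · rw [Category.assoc, h, ← Category.assoc, (hχ' X).2, Category.assoc, (hθ X).2,
      Category.comp_id, Category.id_comp]

/-- Vertical composition of 2-natural transformations. -/
def TwoNatTrans.vcomp [Strict E] {F G H : StrictPseudofunctor D E} (α : TwoNatTrans F G)
    (β : TwoNatTrans G H) : TwoNatTrans F H where
  app X := α.app X ≫ β.app X
  naturality f := by
    rw [← Category.assoc, α.naturality, Category.assoc, β.naturality, Category.assoc]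
  naturality₂ η := by
    refine (eq_conj_iff _ _ _ _).2 ?_
    change wr (Arrow.mk (F.map₂ η)) _ = wl _ (Arrow.mk (H.map₂ η))
    rw [wr_comp, α.cell, wr_wl, β.cell, wl_comp]

/-- Pre-composition of a 2-natural transformation with a 2-functor. -/
def TwoNatTrans.whiskerLeft {A : Type u₃} [Bicategory.{w₃, v₃} A] (H : StrictPseudofunctor A D)
    {F G : StrictPseudofunctor D E} (α : TwoNatTrans F G) :
    TwoNatTrans (H.comp F) (H.comp G) where
  app X := α.app (H.obj X)
  naturality f := α.naturality (H.map f)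
  naturality₂ η := α.naturality₂ (H.map₂ η)

end Iso

/-! ### The sequence `ψₙ`: existence, uniqueness, invertibility. -/

section Psi

variable {C : Type u} [Bicategory.{w, v} C] [Strict C] (κ : CommaChoice C)
  (S : StrictBundleEndo C)

namespace StrictBundleEndo

/-- The identity 2-natural transformation between the downstairs parts of `T Kₙ` and `Kₙ T`. -/
noncomputable def baseId (n : ℕ) : TwoNatTrans (((K κ n).comp S.functor).comp (cod C))
    ((S.functor.comp (K κ n)).comp (cod C)) where
  app p := 𝟙 ((K κ n).obj p).base
  naturality f := id_down_naturality ((K κ n).map f)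
  naturality₂ α := (eq_conj_iff _ _ _ _).2 (id_down_naturality₂ ((K κ n).map₂ α))

/-- The inverse of `baseId`. -/
noncomputable def baseIdInv (n : ℕ) : TwoNatTrans ((S.functor.comp (K κ n)).comp (cod C))
    (((K κ n).comp S.functor).comp (cod C)) where
  app p := 𝟙 ((K κ n).obj p).base
  naturality f := id_down_naturality ((K κ n).map f)
  naturality₂ α := (eq_conj_iff _ _ _ _).2 (id_down_naturality₂ ((K κ n).map₂ α))

variable {κ S} in
-- For a strict bundle endofunctor both bases coincide definitionally, so the equality witness in
-- `IsOverCod` is reflexivity and its `eqToHom` is an identity.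
theorem isOverCod_iff {n : ℕ} (ψ : TwoNatTrans ((K κ n).comp S.functor) (S.functor.comp (K κ n))) :
    ψ.IsOverCod ↔ ∀ p, (ψ.app p).down = (S.baseId κ n).app p :=
  ⟨fun h p => (h p).choose_spec, fun h p => ⟨rfl, h p⟩⟩

/-- The identity `T K₀ ⟶ K₀ T`. -/
noncomputable def psiZero : TwoNatTrans ((K κ 0).comp S.functor) (S.functor.comp (K κ 0)) where
  app p := 𝟙 (S.functor.obj p)
  naturality f := (Category.comp_id (S.functor.map f)).trans
    (Category.id_comp (S.functor.map f)).symm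
  naturality₂ α := (eq_conj_iff _ _ _ _).2 ((wr_id (Arrow.mk (S.functor.map₂ α))).trans
    (wl_id (Arrow.mk (S.functor.map₂ α))).symm)

theorem exists_psi_succ (n : ℕ)
    (ψ : {ψ : TwoNatTrans ((K κ n).comp S.functor) (S.functor.comp (K κ n)) // ψ.IsOverCod}) :
    ∃ χ : TwoNatTrans ((K κ (n + 1)).comp S.functor) (S.functor.comp (K κ (n + 1))),
      χ.IsOverCod ∧ ∀ p, χ.app p ≫ (d₀K κ n).app (S.functor.obj p) =
        S.functor.map ((d₀K κ n).app p) ≫ ψ.1.app p := by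
  obtain ⟨χ, hχ⟩ := TwoNatTrans.exists_lift ((d₀K κ n).whiskerRight S.functor)
    ((d₀K κ n).whiskerLeft S.functor) ψ.1 (fun p => isCartesian_d₀K κ n (S.functor.obj p))
    (S.baseId κ (n + 1)) fun p => by
      refine (Category.id_comp _).trans (Eq.trans ?_
        (congrArg (((d₀K κ n).app p).down ≫ ·) ((isOverCod_iff ψ.1).1 ψ.2 p)).symm)
      exact (Category.comp_id _).symm
  exact ⟨χ, (isOverCod_iff χ).2 fun p => (hχ p).1, fun p => (hχ p).2⟩

/-- The sequence `ψₙ : T Kₙ ⟶ Kₙ T`, together with the fact that it is over `cod`. -/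
noncomputable def psiAux : ∀ n : ℕ,
    {ψ : TwoNatTrans ((K κ n).comp S.functor) (S.functor.comp (K κ n)) // ψ.IsOverCod}
  | 0 => ⟨psiZero κ S, (isOverCod_iff _).2 fun _ => rfl⟩
  | n + 1 => ⟨(exists_psi_succ κ S n (psiAux n)).choose,
      (exists_psi_succ κ S n (psiAux n)).choose_spec.1⟩

/-- The sequence `ψₙ : T Kₙ ⟶ Kₙ T`. -/
noncomputable def psi (n : ℕ) : TwoNatTrans ((K κ n).comp S.functor) (S.functor.comp (K κ n)) :=
  (psiAux κ S n).1

theorem psi_isOverCod (n : ℕ) : (psi κ S n).IsOverCod := (psiAux κ S n).2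

theorem psi_d₀ (n : ℕ) (p : Arr C) : (psi κ S (n + 1)).app p ≫ (d₀K κ n).app (S.functor.obj p) =
    S.functor.map ((d₀K κ n).app p) ≫ (psi κ S n).app p :=
  (exists_psi_succ κ S n (psiAux κ S n)).choose_spec.2 p

theorem psi_isPsiSeq : IsPsiSeq κ S.functor (psi κ S) where
  zero _ := rfl
  succ := psi_d₀ κ S
  succ_isOverCod n := psi_isOverCod κ S (n + 1)

/-- By induction: at each stage both candidates lift the same transformation through the cartesian
`d₀`, with identities downstairs. -/
theorem eq_psi_of_isPsiSeq
    {ψ : ∀ n : ℕ, TwoNatTrans ((K κ n).comp S.functor) (S.functor.comp (K κ n))}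
    (h : IsPsiSeq κ S.functor ψ) : ψ = psi κ S := by
  funext n
  induction n with
  | zero => exact TwoNatTrans.ext' h.zero
  | succ n ih =>
    refine TwoNatTrans.ext' fun p => (isCartesian_d₀K κ n (S.functor.obj p)).hom_ext ?_ ?_
    · exact ((isOverCod_iff _).1 (h.succ_isOverCod n) p).trans
        ((isOverCod_iff _).1 (psi_isOverCod κ S (n + 1)) p).symm
    · exact (h.succ n p).trans ((congrArg (fun χ : TwoNatTrans _ _ =>
        S.functor.map ((d₀K κ n).app p) ≫ χ.app p) ih).trans (psi_d₀ κ S n p).symm)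

variable {S} in
theorem isCartesian_map (hS : IsIndexed S.functor) {p q : Arr C} {f : p ⟶ q}
    (hf : Arr.IsCartesian f) : Arr.IsCartesian (S.functor.map f) := hS f hf

variable {S} in
-- Indexedness makes T d₀ cartesian, so ψₙ₊₁ compares two cartesian transformations lying over the
-- isomorphism ψₙ and is the identity downstairs.
theorem psi_isTwoNatIso (hS : IsIndexed S.functor) (n : ℕ) : (psi κ S n).IsTwoNatIso := by
  induction n with
  | zero =>
    refine ⟨⟨fun p => 𝟙 (S.functor.obj p), fun f => (Category.comp_id (S.functor.map f)).trans
      (Category.id_comp (S.functor.map f)).symm, fun α => (eq_conj_iff _ _ _ _).2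
      ((wr_id (Arrow.mk (S.functor.map₂ α))).trans
        (wl_id (Arrow.mk (S.functor.map₂ α))).symm)⟩, fun p => ?_⟩
    exact ⟨Category.id_comp (𝟙 (S.functor.obj p)), Category.id_comp (𝟙 (S.functor.obj p))⟩
  | succ n ih =>
    refine TwoNatTrans.isTwoNatIso_of_isCartesian ((d₀K κ n).whiskerRight S.functor)
      ((d₀K κ n).whiskerLeft S.functor) (ψ := psi κ S n) _
      (fun p => isCartesian_map hS (isCartesian_d₀K κ n p))
      (fun p => isCartesian_d₀K κ n (S.functor.obj p)) ih (baseIdInv κ S (n + 1))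
      (fun p => ?_) (fun p => ?_) (psi_d₀ κ S n)
    · exact (congrArg (· ≫ (baseIdInv κ S (n + 1)).app p)
        ((isOverCod_iff _).1 (psi_isOverCod κ S (n + 1)) p)).trans (Category.id_comp _)
    · exact (congrArg ((baseIdInv κ S (n + 1)).app p ≫ ·)
        ((isOverCod_iff _).1 (psi_isOverCod κ S (n + 1)) p)).trans (Category.id_comp _)

end StrictBundleEndo

end Psi

/-! ### The unit and multiplication of `L` lifted to the `Kₙ`, and the shift from `K₂` to `K₁ L`. -/

section PsiBullet

variable {C : Type u} [Bicategory.{w, v} C] [Strict C] (κ : CommaChoice C)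

/-- The component `K₁ p ⟶ p` of `d₀`. -/
noncomputable abbrev d₀KOne (p : Arr C) : (K κ 1).obj p ⟶ p := (d₀K κ 0).app p

/-- The component `K₂ p ⟶ K₁ p` of `d₀`. -/
noncomputable abbrev d₀KTwo (p : Arr C) : (K κ 2).obj p ⟶ (K κ 1).obj p := (d₀K κ 1).app p

/-- The component `K₁ p ⟶ L p` of `d₁`. -/
noncomputable abbrev d₁Hom (p : Arr C) : (K κ 1).obj p ⟶ Lobj κ p := (d₁ κ).app p

/-- The component at `p` of the unit of `L`, lifted to `K₁`. -/
noncomputable def unitK (p : Arr C) : p ⟶ (K κ 1).obj p :=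
  Arr.Hom.mk (unitUp κ p) (unitUp κ ⟨𝟙 p.base⟩) (unitUp_naturality κ ((toIdBundle C).app p)).symm

theorem unitK_d₀K (p : Arr C) : unitK κ p ≫ d₀KOne κ p = 𝟙 p :=
  Arr.hom_ext (unitUp_d₀ κ p) (unitUp_d₀ κ ⟨𝟙 p.base⟩)

theorem unitK_d₁ (p : Arr C) : unitK κ p ≫ d₁Hom κ p = unitHom κ p :=
  Arr.hom_ext (Category.comp_id _) (unitUp_d₁ κ ⟨𝟙 p.base⟩)

/-- The component at `p` of the multiplication of `L`, lifted to `K₂ ⟶ K₁`. -/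
noncomputable def multK (p : Arr C) : (K κ 2).obj p ⟶ (K κ 1).obj p :=
  Arr.Hom.mk (multUp κ p) (multUp κ ⟨𝟙 p.base⟩) (multUp_naturality κ ((toIdBundle C).app p)).symm

theorem multK_d₀K (p : Arr C) :
    multK κ p ≫ d₀KOne κ p = d₀KTwo κ p ≫ d₀KOne κ p :=
  Arr.hom_ext (multUp_d₀ κ p) (multUp_d₀ κ ⟨𝟙 p.base⟩)

theorem LmapUp_comp {p q r : Arr C} (f : p ⟶ q) (g : q ⟶ r) :
    LmapUp κ (f ≫ g) = LmapUp κ f ≫ LmapUp κ g :=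
  congrArg Arr.Hom.up ((L κ).map_comp f g)

/-- The 1-cell `Φ₂ B ⟶ Φ B` induced by `d₁ : Φ B ⟶ B`. -/
noncomputable def shiftDown (B : C) : (κ (Lobj κ ⟨𝟙 B⟩)).pt ⟶ (κ ⟨𝟙 B⟩).pt :=
  LmapUp κ ((toIdBundle C).app (Lobj κ ⟨𝟙 B⟩))

theorem shiftDown_d₀ (B : C) :
    shiftDown κ B ≫ (κ ⟨𝟙 B⟩).d₀ = (κ (Lobj κ ⟨𝟙 B⟩)).d₀ ≫ (κ ⟨𝟙 B⟩).d₁ :=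
  LmapUp_d₀ κ ((toIdBundle C).app (Lobj κ ⟨𝟙 B⟩))

theorem shiftDown_d₁ (B : C) : shiftDown κ B ≫ (κ ⟨𝟙 B⟩).d₁ = (κ (Lobj κ ⟨𝟙 B⟩)).d₁ :=
  (LmapUp_d₁ κ ((toIdBundle C).app (Lobj κ ⟨𝟙 B⟩))).trans (Category.comp_id _)

/-- Functoriality of `L` applied to two factorizations of the same square from `Lobj κ p` to the
identity bundle, one through `r` and one through d₁ : Φ B → B. It provides the commuting square both
for `shiftK`, with `f` an identity, and for `shiftPsi`, with `f` a component of Ψ. -/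
theorem LmapUp_shiftDown {p : Arr C} {E : C} {r : E ⟶ p.base} (f : Lobj κ p ⟶ ⟨r⟩)
    (hf : f.down = 𝟙 p.base) : LmapUp κ f ≫ LmapUp κ ((toIdBundle C).app ⟨r⟩) =
      LmapUp κ (Lmap κ ((toIdBundle C).app p)) ≫ shiftDown κ p.base := by
  have e : f ≫ (toIdBundle C).app ⟨r⟩ = Lmap κ ((toIdBundle C).app p) ≫
      (toIdBundle C).app (Lobj κ ⟨𝟙 p.base⟩) := by
    refine Arr.hom_ext ?_ ?_
    · exact f.w.trans ((congrArg ((κ p).d₁ ≫ ·) hf).trans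
        (LmapUp_d₁ κ ((toIdBundle C).app p)).symm)
    · exact congrArg (· ≫ 𝟙 p.base) hf
  exact (LmapUp_comp κ _ _).symm.trans ((congrArg (fun g => LmapUp κ g) e).trans
    (LmapUp_comp κ _ _))

/-- The 1-cell `K₂ p ⟶ K₁ L p` which is the identity upstairs. -/
noncomputable def shiftK (p : Arr C) : (K κ 2).obj p ⟶ (K κ 1).obj (Lobj κ p) :=
  Arr.Hom.mk (𝟙 (κ (Lobj κ p)).pt) (shiftDown κ p.base) (by
    refine Eq.trans ?_ (LmapUp_shiftDown κ (𝟙 (Lobj κ p)) rfl)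
    exact congrArg (· ≫ LmapUp κ ((toIdBundle C).app (Lobj κ p)))
      (congrArg Arr.Hom.up ((L κ).map_id (Lobj κ p))).symm)

theorem shiftK_d₀K (p : Arr C) :
    shiftK κ p ≫ d₀KOne κ (Lobj κ p) = d₀KTwo κ p ≫ d₁Hom κ p :=
  Arr.hom_ext ((Category.id_comp _).trans (Category.comp_id _).symm) (shiftDown_d₀ κ p.base)

/-- This is how the multiplication of `L` is seen from `K₂`: upstairs both sides are c, since the
shift and d₁ are identities there, and downstairs both are the last projection d₁. -/
theorem shiftK_d₁ (p : Arr C) : shiftK κ p ≫ d₁Hom κ (Lobj κ p) ≫ multHom κ p =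
    multK κ p ≫ d₁Hom κ p := by
  refine Arr.hom_ext ?_ ?_
  · exact (Category.id_comp _).trans ((Category.id_comp _).trans (Category.comp_id _).symm)
  · exact (congrArg (shiftDown κ p.base ≫ ·) (Category.comp_id _)).trans
      ((shiftDown_d₁ κ p.base).trans (multUp_d₁ κ ⟨𝟙 p.base⟩).symm)

/-! ### Compatibility of `ψₙ` with the lifted structure, and the transition `Ψ`. -/

namespace StrictBundleEndo

variable (S : StrictBundleEndo C)

theorem psi_down (n : ℕ) (p : Arr C) :
    ((psi κ S n).app p).down = 𝟙 ((K κ n).obj p).base :=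
  (isOverCod_iff _).1 (psi_isOverCod κ S n) p

/-- The component `T Kₙ p ⟶ Kₙ T p` of `ψₙ`. -/
noncomputable abbrev psiHom (n : ℕ) (p : Arr C) :
    S.functor.obj ((K κ n).obj p) ⟶ (K κ n).obj (S.functor.obj p) := (psi κ S n).app p

theorem psiHom_one_d₀KOne (p : Arr C) : psiHom κ S 1 p ≫ d₀KOne κ (S.functor.obj p) =
    S.functor.map (d₀KOne κ p) :=
  (psi_d₀ κ S 0 p).trans (Category.comp_id (S.functor.map ((d₀K κ 0).app p)))

theorem psiHom_two_d₀KTwo (p : Arr C) : psiHom κ S 2 p ≫ d₀KTwo κ (S.functor.obj p) =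
    S.functor.map (d₀KTwo κ p) ≫ psiHom κ S 1 p :=
  psi_d₀ κ S 1 p

theorem isCartesian_d₀KOne (p : Arr C) : Arr.IsCartesian (d₀KOne κ p) := isCartesian_d₀K κ 0 p

/-- Both sides have the same downstairs part and become the identity after the cartesian d₀. -/
theorem map_unitK_psiHom (p : Arr C) :
    S.functor.map (unitK κ p) ≫ psiHom κ S 1 p = unitK κ (S.functor.obj p) := by
  refine (isCartesian_d₀KOne κ (S.functor.obj p)).hom_ext ?_ ?_
  · exact (congrArg ((unitK κ p).down ≫ ·) (psi_down κ S 1 p)).trans (Category.comp_id _)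
  · rw [Category.assoc, psiHom_one_d₀KOne, unitK_d₀K, ← S.functor.map_comp, unitK_d₀K,
      S.functor.map_id]

/-- The downstairs parts agree, and after the cartesian d₀ both sides become T applied to the double
projection d₀d₀. -/
theorem map_multK_psiHom (p : Arr C) : S.functor.map (multK κ p) ≫ psiHom κ S 1 p =
    psiHom κ S 2 p ≫ multK κ (S.functor.obj p) := by
  refine (isCartesian_d₀KOne κ (S.functor.obj p)).hom_ext ?_ ?_
  · exact ((congrArg ((multK κ p).down ≫ ·) (psi_down κ S 1 p)).trans
      (Category.comp_id _)).trans ((congrArg (· ≫ (multK κ p).down) (psi_down κ S 2 p)).trans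
        (Category.id_comp _)).symm
  · rw [Category.assoc, psiHom_one_d₀KOne, ← S.functor.map_comp, multK_d₀K, Category.assoc,
      multK_d₀K, S.functor.map_comp, ← psiHom_one_d₀KOne, ← Category.assoc, ← psiHom_two_d₀KTwo,
      Category.assoc]

variable {κ S} {Ψ : TwoNatTrans (S.functor.comp (L κ)) ((L κ).comp S.functor)}

theorem psiBullet_down (hΨ : Ψ.IsOverCod) (p : Arr C) : (Ψ.app p).down = 𝟙 p.base :=
  (hΨ p).choose_spec

variable (Ψ) in
/-- The composite `K₁ T p ⟶ L T p ⟶ T L p` of `d₁` and `Ψ`. -/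
noncomputable def d₁PsiBullet (p : Arr C) :
    (K κ 1).obj (S.functor.obj p) ⟶ S.functor.obj (Lobj κ p) :=
  (d₁ κ).app (S.functor.obj p) ≫ Ψ.app p

theorem psiHom_d₁PsiBullet (hΨ : IsPsiBullet κ S.functor (psi κ S 1) Ψ) (p : Arr C) :
    psiHom κ S 1 p ≫ d₁PsiBullet Ψ p = S.functor.map (d₁Hom κ p) :=
  hΨ.d₁_comp p

/-- The 1-cell `K₂ T p ⟶ K₁ T L p` given upstairs by `L Ψ`. -/
noncomputable def shiftPsi (hΨ : Ψ.IsOverCod) (p : Arr C) :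
    (K κ 2).obj (S.functor.obj p) ⟶ (K κ 1).obj (S.functor.obj (Lobj κ p)) :=
  Arr.Hom.mk (LmapUp κ (Ψ.app p)) (shiftDown κ p.base)
    (LmapUp_shiftDown κ (p := S.functor.obj p) (Ψ.app p) (psiBullet_down hΨ p))

theorem shiftPsi_d₀K (hΨ : Ψ.IsOverCod) (p : Arr C) :
    shiftPsi hΨ p ≫ d₀KOne κ (S.functor.obj (Lobj κ p)) =
      d₀KTwo κ (S.functor.obj p) ≫ d₁PsiBullet Ψ p := by
  refine Arr.hom_ext ?_ ?_
  · exact (LmapUp_d₀ κ (Ψ.app p)).trans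
      (congrArg ((κ (Lobj κ (S.functor.obj p))).d₀ ≫ ·) (Category.id_comp (Ψ.app p).up).symm)
  · refine (shiftDown_d₀ κ p.base).trans
      (congrArg ((κ (Lobj κ ⟨𝟙 p.base⟩)).d₀ ≫ ·) ?_)
    exact (Category.comp_id _).symm.trans
      (congrArg ((κ ⟨𝟙 p.base⟩).d₁ ≫ ·) (psiBullet_down hΨ p).symm)

/-- After the cartesian d₀ both sides become T applied to d₀ followed by d₁; on the left this uses
the defining equation of Ψ. -/
theorem psiHom_shiftPsi (hΨ : IsPsiBullet κ S.functor (psi κ S 1) Ψ) (p : Arr C) :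
    psiHom κ S 2 p ≫ shiftPsi hΨ.isOverCod p =
      S.functor.map (shiftK κ p) ≫ psiHom κ S 1 (Lobj κ p) := by
  refine (isCartesian_d₀KOne κ (S.functor.obj (Lobj κ p))).hom_ext ?_ ?_
  · exact ((congrArg (· ≫ shiftDown κ p.base) (psi_down κ S 2 p)).trans
      (Category.id_comp _)).trans ((congrArg (shiftDown κ p.base ≫ ·)
        (psi_down κ S 1 (Lobj κ p))).trans (Category.comp_id _)).symm
  · rw [Category.assoc, shiftPsi_d₀K, ← Category.assoc, psiHom_two_d₀KTwo, Category.assoc,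
      psiHom_d₁PsiBullet hΨ, Category.assoc, psiHom_one_d₀KOne, ← S.functor.map_comp,
      ← S.functor.map_comp, shiftK_d₀K]

theorem unitK_d₁PsiBullet (hΨ : IsPsiBullet κ S.functor (psi κ S 1) Ψ) (p : Arr C) :
    unitK κ (S.functor.obj p) ≫ d₁PsiBullet Ψ p = S.functor.map (unitHom κ p) := by
  rw [← map_unitK_psiHom, Category.assoc, psiHom_d₁PsiBullet hΨ, ← S.functor.map_comp, unitK_d₁]

/-- The multiplication law at the level of K₂ T. Precomposed with the invertible ψ₂, both sides are
the images under T of the two sides of `shiftK_d₁`. -/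
theorem multK_d₁PsiBullet (hS : IsIndexed S.functor)
    (hΨ : IsPsiBullet κ S.functor (psi κ S 1) Ψ) (p : Arr C) :
    multK κ (S.functor.obj p) ≫ d₁PsiBullet Ψ p = shiftPsi hΨ.isOverCod p ≫
      d₁PsiBullet Ψ (Lobj κ p) ≫ S.functor.map (multHom κ p) := by
  obtain ⟨θ, hθ⟩ := psi_isTwoNatIso κ hS 2
  have : IsSplitEpi (psiHom κ S 2 p) := ⟨⟨⟨θ.app p, (hθ p).2⟩⟩⟩
  rw [← cancel_epi (psiHom κ S 2 p), ← Category.assoc, ← map_multK_psiHom, Category.assoc,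
    psiHom_d₁PsiBullet hΨ, ← Category.assoc (psiHom κ S 2 p), psiHom_shiftPsi hΨ, Category.assoc,
    ← Category.assoc (psiHom κ S 1 (Lobj κ p)), psiHom_d₁PsiBullet hΨ, ← S.functor.map_comp,
    ← S.functor.map_comp, ← S.functor.map_comp, shiftK_d₁]

theorem psiBullet_isTwoTransition (hS : IsIndexed S.functor)
    (hΨ : IsPsiBullet κ S.functor (psi κ S 1) Ψ) :
    IsTwoTransition (Lmonad κ) (Lmonad κ) S.functor Ψ where
  unit p := by
    refine Arr.hom_ext ?_ ?_
    -- Upstairs d₁ is an identity, so `d₁PsiBullet` has the same upstairs part as Ψ up to a unit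
    -- law; the multiplication case uses this too.
    · refine Eq.trans ?_ (congrArg Arr.Hom.up (unitK_d₁PsiBullet hΨ p))
      exact congrArg (unitUp κ (S.functor.obj p) ≫ ·) (Category.id_comp (Ψ.app p).up).symm
    · exact (Category.id_comp _).trans (psiBullet_down hΨ.isOverCod p)
  mult p := by
    have d := psiBullet_down hΨ.isOverCod
    refine Arr.hom_ext ?_ ?_
    · refine Eq.trans ?_ ((congrArg Arr.Hom.up (multK_d₁PsiBullet hS hΨ p)).trans ?_)
      · exact congrArg (multUp κ (S.functor.obj p) ≫ ·) (Category.id_comp (Ψ.app p).up).symm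
      · exact congrArg (fun x => LmapUp κ (Ψ.app p) ≫ x ≫ (S.functor.map (multHom κ p)).up)
          (Category.id_comp (Ψ.app (Lobj κ p)).up)
    · refine (Category.id_comp (Ψ.app p).down).trans (Eq.symm ?_)
      exact (congrArg ((Ψ.app p).down ≫ ·) ((Category.comp_id _).trans (d (Lobj κ p)))).trans
        (Category.comp_id _)

theorem exists_isPsiBullet (hS : IsIndexed S.functor) :
    ∃ Ψ : TwoNatTrans (S.functor.comp (L κ)) ((L κ).comp S.functor),
      IsPsiBullet κ S.functor (psi κ S 1) Ψ := by
  obtain ⟨θ, hθ⟩ := psi_isTwoNatIso κ hS 1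
  -- The 2-natural transformation K₁ T → T L that must factor as d₁ followed by Ψ. Its downstairs
  -- part is d₁ : Φ B → B, so Ψ is obtained by keeping the upstairs part and putting 1_B downstairs.
  let χ := θ.vcomp ((d₁ κ).whiskerRight S.functor)
  have hχ : ∀ p, (χ.app p).down = (κ ⟨𝟙 p.base⟩).d₁ := fun p => by
    have e : (θ.app p).down = 𝟙 ((K κ 1).obj p).base :=
      (Category.comp_id _).symm.trans ((congrArg ((θ.app p).down ≫ ·)
        (psi_down κ S 1 p)).symm.trans (congrArg Arr.Hom.down (hθ p).2))
    exact (congrArg (· ≫ (κ ⟨𝟙 p.base⟩).d₁) e).trans (Category.id_comp _)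
  have nat : ∀ {p q : Arr C} (f : p ⟶ q), Arr.Hom.up (_ ≫ χ.app q) = Arr.Hom.up (χ.app p ≫ _) :=
    fun f => congrArg Arr.Hom.up (χ.naturality f)
  refine ⟨⟨fun p => Arr.Hom.mk (χ.app p).up (𝟙 p.base) ?_, fun f => Arr.hom_ext (nat f)
    (id_down_naturality f), fun α => Arr.eq_conj _ _ _ _
    (congrArg Arr.upArrow (χ.cell α)) (id_down_naturality₂ α)⟩, fun p => ⟨rfl, rfl⟩, fun p => ?_⟩
  -- The new square commutes because the bundle K₁ T p followed by d₁ : Φ B → B is the projection d₁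
  -- of the comma object of T p.
  · exact (χ.app p).w.trans ((congrArg (LmapUp κ ((toIdBundle C).app (S.functor.obj p)) ≫ ·)
      (hχ p)).trans (LmapUp_d₁ κ ((toIdBundle C).app (S.functor.obj p))))
  · refine Arr.hom_ext ?_ ?_
    · refine (congrArg (((psi κ S 1).app p).up ≫ ·) (Category.id_comp (χ.app p).up)).trans
        ((Category.assoc _ _ _).symm.trans ((congrArg (· ≫ (S.functor.map (d₁Hom κ p)).up)
          (congrArg Arr.Hom.up (hθ p).1)).trans (Category.id_comp _)))
    · exact (congrArg (· ≫ (κ ⟨𝟙 p.base⟩).d₁ ≫ 𝟙 p.base) (psi_down κ S 1 p)).trans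
        ((Category.id_comp _).trans (Category.comp_id _))

/-- Cancelling the invertible ψ₁ determines d₁ followed by Ψ, hence Ψ upstairs, where d₁ is an
identity; downstairs Ψ is an identity by hypothesis. -/
theorem isPsiBullet_unique (hS : IsIndexed S.functor)
    {Ψ' : TwoNatTrans (S.functor.comp (L κ)) ((L κ).comp S.functor)}
    (hΨ : IsPsiBullet κ S.functor (psi κ S 1) Ψ) (hΨ' : IsPsiBullet κ S.functor (psi κ S 1) Ψ') :
    Ψ = Ψ' := by
  refine TwoNatTrans.ext' fun p => Arr.hom_ext ?_
    ((psiBullet_down hΨ.isOverCod p).trans (psiBullet_down hΨ'.isOverCod p).symm)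
  obtain ⟨θ, hθ⟩ := psi_isTwoNatIso κ hS 1
  have : IsSplitEpi (psiHom κ S 1 p) := ⟨⟨⟨θ.app p, (hθ p).2⟩⟩⟩
  have e : d₁PsiBullet Ψ p = d₁PsiBullet Ψ' p := by
    rw [← cancel_epi (psiHom κ S 1 p), psiHom_d₁PsiBullet hΨ, psiHom_d₁PsiBullet hΨ']
  exact (Category.id_comp _).symm.trans ((congrArg Arr.Hom.up e).trans (Category.id_comp _))

end StrictBundleEndo

end PsiBullet

end ArrowTwoCat

/-! ### The theorem, by reduction to a strict bundle endofunctor. -/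

theorem mainTheorem3 {C : Type u} [Bicategory.{w, v} C] [Strict C] [Representable C]
    (κ : CommaChoice C) (T : StrictPseudofunctor (Arr C) (Arr C)) (hT : IsBundleEndo T)
    (hT' : IsIndexed T) :
    ∃ ψ : ∀ n : ℕ, TwoNatTrans ((K κ n).comp T) (T.comp (K κ n)),
      IsPsiSeq κ T ψ ∧ (∀ ψ', IsPsiSeq κ T ψ' → ψ' = ψ) ∧ (∀ n, (ψ n).IsTwoNatIso) ∧
      ∃ Ψ : TwoNatTrans (T.comp (L κ)) ((L κ).comp T),
        IsPsiBullet κ T (ψ 1) Ψ ∧ (∀ Ψ', IsPsiBullet κ T (ψ 1) Ψ' → Ψ' = Ψ) ∧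
        IsTwoTransition (Lmonad κ) (Lmonad κ) T Ψ := by
  obtain ⟨S, rfl⟩ := hT.exists_strict
  obtain ⟨Ψ, hΨ⟩ := StrictBundleEndo.exists_isPsiBullet (κ := κ) hT'
  exact ⟨S.psi κ, S.psi_isPsiSeq κ, fun _ h => S.eq_psi_of_isPsiSeq κ h,
    StrictBundleEndo.psi_isTwoNatIso κ hT', Ψ, hΨ,
    fun _ h => StrictBundleEndo.isPsiBullet_unique hT' h hΨ,
    StrictBundleEndo.psiBullet_isTwoTransition hT' hΨ⟩
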